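/- Let $d\ge 1$, $p\ge 1$, $0<\alpha\le p$, $T>0$, $M>0$, and let $B(M)$ be the closed ball of radius $M$ centred at $0$ in $\mathbb{R}^d$. **Limit family.** Let $\rho_0$ be a probability measure on $\mathbb{R}^d$ supported in $B(M)$ and let $u_0\in L^\infty(\rho_0;\mathbb{R}^d)$ with $\|u_0\|_{L^\infty(\rho_0)}\le M$. Let $1\le N_1<N_2<\dots$ be integers and, for each $N=N_k$, let $(x_i^N,v_i^N)_{i=1}^N$ be a classical solution on $[0,T]$, with $x_i^N(t)\ne x_j^N(t)$ for all $i\neq j$ and $t\in[0,T]$, of $$\dot x_i=v_i,\qquad \dot v_i=\frac1N\sum_{j\ne i}\frac{|v_j-v_i|^{p-2}(v_j-v_i)}{|x_i-x_j|^\alpha},$$ with initial data satisfying $|x^N_i(0)|\le M$, $|v^N_i(0)|\le M$, and, narrowly along $N=N_k\to\infty$, $$\frac1N\sum_i\delta_{x_i^N(0)}\rightharpoonup\rho_0,\qquad \frac1N\sum_i v_i^N(0)\,\delta_{x_i^N(0)}\rightharpoonup u_0\rho_0 .$$ Let $\mu^N_t:=\frac1N\sum_i\delta_{x_i^N(t)}\otimes\delta_{v_i^N(t)}$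 be the atomic solutions and $\rho^N_t$ their $x$-marginals. Assume that, along $N=N_k\to\infty$, * $\mu^N_t\otimes\lambda^1(t)\rightharpoonup\mu_t\otimes\lambda^1(t)$ narrowly on $[0,T]\times\mathbb{R}^{2d}$, where $\lambda^1$ is the Lebesgue measure on $[0,T]$ and $t\mapsto\mu_t\in\mathcal P(\mathbb{R}^{2d})$ is measurable; * $\rho^N\to\rho$ in $C([0,T];(\mathcal P(\mathbb{R}^d),d_{BL}))$, where $d_{BL}(\mu,\nu)=\sup\{|\int f\,d\mu-\int f\,d\nu| : \|f\|_\infty\le1,\ [f]_{Lip}\le 1\}$. **Claim.** For a.e. $t\in[0,T]$ the $x$-marginal of $\mu_t$ is $\rho_t$ and $\mu_t$ is supported in $B((T+1)M)\times B(M)$. Moreover: 1. (MP, locally mass preserving) for every bounded $C\subset\mathbb{R}^d$ and all $0\le t_0\le t\le T$, $$\rho_t\big(\overline C+(t-t_0)B(M)\big)\ge\rho_{t_0}(C).$$ 2. (SF, steadily flowing) With $T^{t_0,t}(x,v):=(x-(t-t_0)v,\,v)$, there is a set $A\subset[0,T]$ of full Lebesgue measure such that for all $t_0\in A$ and all $0\le\phi\in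 C_c^\infty(\mathbb{R}^d)$ the measures $$\rho_{t_0,t}[\phi](B):=\int_{B\times\mathbb{R}^d}\phi(v)\,d\,T^{t_0,t}_\#\mu_t,\qquad B\subset\mathbb{R}^d\text{ Borel},$$ are narrowly continuous at $t=t_0$ as a function of $t\in A$. 3. In particular, there is a set $A\subset[0,T]$ of full Lebesgue measure such that for every $t_0\in A$ the pushforwards $T^{t_0,t}_\#\mu_t$ are narrowly continuous at $t=t_0$ as a function of $t\in A$. -/

import Mathlib

open MeasureTheory Filter Topology Set
open scoped ENNReal ContDiff Pointwise BoundedContinuousFunction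

namespace PAlign

/-- `ℝ^d` with the Euclidean norm; it serves as the space of positions and of velocities. -/
abbrev E (d : ℕ) : Type := EuclideanSpace ℝ (Fin d)

/-- Classical, non-collisional solution on `[0,T]` of the `p`-Cucker-Smale particle system
`x_i' = v_i`, `v_i' = (1/N) ∑_{j ≠ i} |v_j - v_i|^(p-2) (v_j - v_i) / |x_i - x_j|^α`
(with one-sided derivatives at the end points).  The right-hand side makes sense only away from
collisions, hence `noncollisional`. -/
structure IsParticleSolution {d N : ℕ} (p α T : ℝ) (x v : Fin N → ℝ → E d) : Prop where
  deriv_position : ∀ i, ∀ t ∈ Icc 0 T, HasDerivWithinAt (x i) (v i t) (Icc 0 T) t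
  deriv_velocity : ∀ i, ∀ t ∈ Icc 0 T, HasDerivWithinAt (v i)
    ((N : ℝ)⁻¹ • ∑ j ∈ Finset.univ.erase i,
      (‖v j t - v i t‖ ^ (p - 2) / ‖x i t - x j t‖ ^ α) • (v j t - v i t)) (Icc 0 T) t
  noncollisional : ∀ i j, i ≠ j → ∀ t ∈ Icc 0 T, x i t ≠ x j t

/-- The atomic solution: the empirical measures `μ^N_t = (1/N) ∑_i δ_{x_i(t)} ⊗ δ_{v_i(t)}`. -/
noncomputable def atomic {d N : ℕ} (x v : Fin N → ℝ → E d) (t : ℝ) : Measure (E d × E d) :=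
  (N : ℝ≥0∞)⁻¹ • ∑ i, Measure.dirac (x i t, v i t)

/-- The bounded-Lipschitz distance: the supremum of `|∫ f dμ - ∫ f dν|` over all `f` with
`‖f‖_∞ ≤ 1` and Lipschitz constant at most `1`. -/
noncomputable def dBL {d : ℕ} (μ ν : Measure (E d)) : ℝ≥0∞ :=
  ⨆ f : {f : E d → ℝ // (∀ x, |f x| ≤ 1) ∧ LipschitzWith 1 f},
    ENNReal.ofReal |∫ x, f.1 x ∂μ - ∫ x, f.1 x ∂ν|

/-- Narrow convergence of the space-time measures `m k t ⊗ dt` to `μ t ⊗ dt` on `[0,T] × X`, tested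
with bounded continuous functions of `(t, z)`. -/
def TendstoSpaceTime {X : Type*} [TopologicalSpace X] [MeasurableSpace X] (T : ℝ)
    (m : ℕ → ℝ → Measure X) (μ : ℝ → Measure X) : Prop :=
  ∀ f : (ℝ × X) →ᵇ ℝ,
    Tendsto (fun k => ∫ t in (0 : ℝ)..T, ∫ z, f (t, z) ∂(m k t)) atTop
      (𝓝 (∫ t in (0 : ℝ)..T, ∫ z, f (t, z) ∂(μ t)))

/-- The limit family of the atomic solutions.  The initial datum is `(ρ₀, u₀)`, with `ρ₀` a
probability measure supported in the ball of radius `M` and `u₀ ∈ L^∞(ρ₀)` bounded by `M`.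
The `k`-th member of the (sub)sequence has `N k` particles, with trajectories `x k`, `v k`.
The family `μ` is the disintegration in time of the narrow limit of the atomic solutions, and `ρ` is
the limit of their local densities in `C([0,T]; (𝒫(ℝ^d), d_BL))` (uniform convergence in time). -/
structure IsLimitFamily {d : ℕ} (p α T M : ℝ) (ρ₀ : Measure (E d)) (u₀ : E d → E d)
    (N : ℕ → ℕ) (x v : ∀ k, Fin (N k) → ℝ → E d)
    (μ : ProbabilityTheory.Kernel ℝ (E d × E d)) (ρ : ℝ → Measure (E d)) : Prop where
  prob_init : IsProbabilityMeasure ρ₀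
  support_init : ρ₀ (Metric.closedBall 0 M)ᶜ = 0
  measurable_velocity_init : AEStronglyMeasurable u₀ ρ₀
  bound_velocity_init : ∀ᵐ y ∂ρ₀, ‖u₀ y‖ ≤ M
  pos_number : ∀ k, 0 < N k
  strictMono_number : StrictMono N
  solution : ∀ k, IsParticleSolution p α T (x k) (v k)
  bound_position : ∀ k i, ‖x k i 0‖ ≤ M
  bound_velocity : ∀ k i, ‖v k i 0‖ ≤ M
  tendsto_density_init : ∀ f : E d →ᵇ ℝ,
    Tendsto (fun k => (N k : ℝ)⁻¹ * ∑ i, f (x k i 0)) atTop (𝓝 (∫ y, f y ∂ρ₀))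
  tendsto_momentum_init : ∀ f : E d →ᵇ ℝ,
    Tendsto (fun k => (N k : ℝ)⁻¹ • ∑ i, f (x k i 0) • v k i 0) atTop (𝓝 (∫ y, f y • u₀ y ∂ρ₀))
  prob_limit : ∀ t ∈ Icc 0 T, IsProbabilityMeasure (μ t)
  tendsto_limit : TendstoSpaceTime T (fun k => atomic (x k) (v k)) (fun t => μ t)
  prob_density : ∀ t ∈ Icc 0 T, IsProbabilityMeasure (ρ t)
  tendsto_density : ∀ ε : ℝ≥0∞, 0 < ε →
    ∀ᶠ k in atTop, ∀ t ∈ Icc 0 T, dBL (atomic (x k) (v k) t).fst (ρ t) ≤ ε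

/-- Local mass preservation (MP) of the local densities `ρ_t`, `t ∈ [0,T]`. -/
def LocallyMassPreserving {d : ℕ} (T M : ℝ) (ρ : ℝ → Measure (E d)) : Prop :=
  ∀ C : Set (E d), Bornology.IsBounded C → ∀ t₀ t : ℝ, 0 ≤ t₀ → t₀ ≤ t → t ≤ T →
    ρ t₀ C ≤ ρ t (closure C + (t - t₀) • Metric.closedBall (0 : E d) M)

/-- The map `T^{t₀,t}(x, v) = (x - (t - t₀) v, v)`. -/
def flowBack {d : ℕ} (t₀ t : ℝ) (z : E d × E d) : E d × E d := (z.1 - (t - t₀) • z.2, z.2)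

/-- The measure `ρ_{t₀,t}[φ](B) = ∫_{B × ℝ^d} φ(v) d(T^{t₀,t}_# μ_t)`, for `φ ≥ 0`. -/
noncomputable def flowedDensity {d : ℕ} (μ : ℝ → Measure (E d × E d)) (φ : E d → ℝ) (t₀ t : ℝ) :
    Measure (E d) :=
  (((μ t).map (flowBack t₀ t)).withDensity (fun z => ENNReal.ofReal (φ z.2))).map Prod.fst

/-- `t ↦ m t`, restricted to `A`, is narrowly continuous at `t₀`. -/
def NarrowContWithinAt {X : Type*} [TopologicalSpace X] [MeasurableSpace X]
    (m : ℝ → Measure X) (A : Set ℝ) (t₀ : ℝ) : Prop :=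
  ∀ ξ : X →ᵇ ℝ, Tendsto (fun t => ∫ y, ξ y ∂(m t)) (𝓝[A] t₀) (𝓝 (∫ y, ξ y ∂(m t₀)))

/-- `A` is a subset of `[0,T]` of full Lebesgue measure. -/
def FullMeasureIn (T : ℝ) (A : Set ℝ) : Prop := A ⊆ Icc 0 T ∧ volume (Icc 0 T \ A) = 0

/-- The steady flow condition (SF) of the family `μ_t`, `t ∈ [0,T]`. -/
def SteadilyFlowing {d : ℕ} (T : ℝ) (μ : ℝ → Measure (E d × E d)) : Prop :=
  ∃ A : Set ℝ, FullMeasureIn T A ∧ ∀ t₀ ∈ A, ∀ φ : E d → ℝ,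
    ContDiff ℝ ∞ φ → HasCompactSupport φ → (∀ w, 0 ≤ φ w) →
      NarrowContWithinAt (flowedDensity μ φ t₀) A t₀

end PAlign

/-!
The time dependence of the limit is controlled by one monotone function.  For `N` particles the mean
squared speed `K_N(t) = (1/N) ∑_i |v_i|²` is nonincreasing, with `-K_N'` equal to the dissipation
`D_N = (1/N²) ∑_{i,j} |v_j - v_i|^p / |x_i - x_j|^α`.  For a smooth observable `g(x, v)` the force
term in the derivative of `(1/N) ∑_i g(x_i, v_i)`, once symmetrized in `i` and `j`, contains the
difference of the gradients `∇_v g` at the two particles, which is at most a multiple of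
`max (|x_i - x_j|, |v_i - v_j|)`.  As `α ≤ p`, the singular kernel times this factor and the
relative speed is at most `|v_j - v_i|^p / |x_i - x_j|^α` plus a constant
(`rpow_div_mul_max_mul_le`).  Hence `C (t - K_N(t)) ± (1/N) ∑_i g(x_i, v_i)` is nondecreasing in
`t`, with `C` independent of `N` (`exists_monotoneOn_clock_add`).

Monotonicity passes to weak limits in time, up to a null set of times
(`exists_monotoneOn_of_tendsto_integral`), and `|v|²` is itself an admissible observable, since all
states stay in the compact set `(T+1) B(M) × B(M)` by the maximum principle.  Therefore, with
`H(t) = t - ∫ |v|² dμ_t`, on a set of full measure `H` is monotone and the increments of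
`∫ g dμ_t` are bounded by those of `C H`, for all `g` in a countable family of smooth functions that
is uniformly dense on compact sets.  A monotone function has at most countably many discontinuities;
away from these `t ↦ μ_t` is narrowly continuous (`IsLimitFamily.exists_continuousWithinAt`).  Since
velocities are bounded by `M`, the map `T^{t₀,t}` tends to the identity uniformly on the support as
`t → t₀`, so the flowed measures inherit this continuity
(`IsLimitFamily.tendsto_integral_of_continuous`).

Local mass preservation holds because the particles move at speed at most `M`: Lipschitz cutoffs of
the distance to `C` are compared along the particle trajectories, and pass to the limit since
`ρ^N_t → ρ_t` in `d_BL` at each time `t`.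
-/

namespace PAlign

/-! ### Two tools: dense smooth functions and weak limits of monotone functions -/

/-- A countable family of smooth compactly supported functions is uniformly dense in the continuous
functions on every compact set.  It exists because `C(X, ℝ)` is second countable, hence so is its
subspace of smooth compactly supported functions. -/
theorem exists_seq_contDiff_dense_on_compacts (X : Type*) [NormedAddCommGroup X] [NormedSpace ℝ X]
    [FiniteDimensional ℝ X] :
    ∃ g : ℕ → X → ℝ, (∀ n, ContDiff ℝ ∞ (g n)) ∧ (∀ n, HasCompactSupport (g n)) ∧
      ∀ f : X → ℝ, Continuous f → ∀ K : Set X, IsCompact K → ∀ ε > 0,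
        ∃ n, ∀ z ∈ K, |f z - g n z| < ε := by
  have : ProperSpace X := FiniteDimensional.proper ℝ X
  have hnb := fun f : C(X, ℝ) => nhds_basis_uniformity
    (Metric.uniformity_basis_dist.compactConvergenceUniformity (α := X) (β := ℝ)) (x := f)
  set S : Set C(X, ℝ) := {f | ContDiff ℝ ∞ f ∧ HasCompactSupport f} with hS
  have hSne : S.Nonempty := ⟨0, contDiff_const, HasCompactSupport.zero⟩
  obtain ⟨D, hDS, hDc, hD⟩ :=
    (TopologicalSpace.IsSeparable.of_separableSpace S).exists_countable_dense_subset
  have hDne : D.Nonempty := by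
    rw [nonempty_iff_ne_empty]
    rintro rfl
    simpa using hD hSne.some_mem
  obtain ⟨e, rfl⟩ := hDc.exists_eq_range hDne
  refine ⟨fun n => e n, fun n => (hDS ⟨n, rfl⟩).1, fun n => (hDS ⟨n, rfl⟩).2, ?_⟩
  intro f hf K hK ε hε
  obtain ⟨g, hgK, hgc⟩ : ∃ g : C(X, ℝ), (∀ z ∈ K, |f z - g z| < ε / 2) ∧ ContDiff ℝ ∞ g := by
    obtain ⟨g, h1, h2⟩ := (mem_closure_iff_nhds_basis (hnb ⟨f, hf⟩)).1
      (ContinuousMap.dense_setOfPred_contDiff ⟨f, hf⟩) (K, ε / 2) ⟨hK, half_pos hε⟩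
    refine ⟨g, fun z hz => ?_, h1⟩
    have h3 : dist (g z) (f z) < ε / 2 := h2 z hz
    rwa [dist_comm, Real.dist_eq] at h3
  obtain ⟨R, hR, hKR⟩ := hK.isBounded.subset_closedBall_lt 0 0
  let χ : ContDiffBump (0 : X) := ⟨R, R + 1, hR, by linarith⟩
  let h : C(X, ℝ) := ⟨fun z => χ z * g z, χ.continuous.mul g.continuous⟩
  have hh : h ∈ S := ⟨χ.contDiff.mul hgc, χ.hasCompactSupport.mul_right⟩
  obtain ⟨_, ⟨n, rfl⟩, hn⟩ := (mem_closure_iff_nhds_basis (hnb h)).1 (hD hh)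
    (K, ε / 2) ⟨hK, half_pos hε⟩
  refine ⟨n, fun z hz => ?_⟩
  have h1 := hgK z hz
  have h2 : dist (e n z) (h z) < ε / 2 := hn z hz
  have h3 : h z = g z := by
    change χ z * g z = g z
    rw [χ.one_of_mem_closedBall (hKR hz), one_mul]
  rw [h3, dist_comm, Real.dist_eq] at h2
  calc |f z - e n z| ≤ |f z - g z| + |g z - e n z| := abs_sub_le _ _ _
    _ < ε := by linarith

/-- A weak limit of monotone functions is monotone on a set of full measure.  The inequality
`(φₙ ⋆ w) s ≤ (φₙ ⋆ w) t` for `s < t` and a narrow bump function `φₙ` survives the weak limit in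
`w`, and the bump functions are removed at Lebesgue points. -/
theorem exists_monotoneOn_of_tendsto_integral {T : ℝ} {w : ℕ → ℝ → ℝ} {u : ℝ → ℝ}
    (hw : ∀ k, MonotoneOn (w k) (Icc 0 T)) (hu : IntervalIntegrable u volume 0 T) (hT : 0 ≤ T)
    (hlim : ∀ θ : ℝ → ℝ, Continuous θ → HasCompactSupport θ →
      Tendsto (fun k => ∫ t in (0 : ℝ)..T, θ t * w k t) atTop (𝓝 (∫ t in (0 : ℝ)..T, θ t * u t))) :
    ∃ A ⊆ Icc 0 T, volume (Icc 0 T \ A) = 0 ∧ MonotoneOn u A := by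
  let φ : ℕ → ContDiffBump (0 : ℝ) := fun n =>
    ⟨1 / ((n : ℝ) + 1) / 2, 1 / ((n : ℝ) + 1), by positivity, half_lt_self (by positivity)⟩
  have hφ : Tendsto (fun n => (φ n).rOut) atTop (𝓝 0) := tendsto_one_div_add_atTop_nhds_zero_nat
  have hg : Integrable ((Ioc 0 T).indicator u) :=
    ((intervalIntegrable_iff_integrableOn_Ioc_of_le hT).1 hu).integrable_indicator
      measurableSet_Ioc
  have hae := ContDiffBump.ae_convolution_tendsto_right_of_locallyIntegrable (μ := volume)
    (K := 2) hφ (Eventually.of_forall fun n => by simp only [φ]; linarith) hg.locallyIntegrable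
  -- the convolution at `s` is the limit of the integrals of `w k` against a translated bump
  have hconv : ∀ n s, Tendsto (fun k => ∫ t in (0 : ℝ)..T, (φ n).normed volume (s - t) * w k t)
      atTop (𝓝 (convolution ((φ n).normed volume) ((Ioc 0 T).indicator u)
        (ContinuousLinearMap.lsmul ℝ ℝ) volume s)) := by
    intro n s
    have h1 := hlim (fun t => (φ n).normed volume (s - t))
      ((φ n).continuous_normed.comp (by fun_prop))
      ((φ n).hasCompactSupport_normed.comp_homeomorph (Homeomorph.subLeft s))
    convert h1 using 2
    rw [convolution_eq_swap, intervalIntegral.integral_of_le hT,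
      ← integral_indicator measurableSet_Ioc]
    congr 1 with t
    by_cases ht : t ∈ Ioc 0 T <;> simp [ht]
  set B : Set ℝ := {s | Tendsto (fun n => convolution ((φ n).normed volume)
    ((Ioc 0 T).indicator u) (ContinuousLinearMap.lsmul ℝ ℝ) volume s) atTop
      (𝓝 ((Ioc 0 T).indicator u s))} with hB
  refine ⟨Ioo 0 T ∩ B, fun t ht => Ioo_subset_Icc_self ht.1, ?_, ?_⟩
  · have h1 : (Icc 0 T \ (Ioo 0 T ∩ B)) ⊆ {0, T} ∪ Bᶜ := by
      rintro t ⟨ht, h2⟩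
      by_cases hb : t ∈ B
      · left
        have : ¬ (t ∈ Ioo 0 T) := fun h => h2 ⟨h, hb⟩
        simp only [mem_Ioo, not_and, not_lt] at this
        rcases ht.1.eq_or_lt with h | h
        · simp [h]
        · simp [le_antisymm ht.2 (this h)]
      · exact Or.inr hb
    refine measure_mono_null h1 (measure_union_null ?_ hae)
    exact ((finite_singleton T).insert 0).measure_zero _
  · rintro s ⟨hs, hsB⟩ t ⟨ht, htB⟩ hst
    have hsB' : Tendsto _ _ _ := hsB
    have htB' : Tendsto _ _ _ := htB
    rw [indicator_of_mem (Ioo_subset_Ioc_self hs)] at hsB'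
    rw [indicator_of_mem (Ioo_subset_Ioc_self ht)] at htB'
    refine le_of_tendsto_of_tendsto hsB' htB' ?_
    have hsm : ∀ᶠ n in atTop, (φ n).rOut < min s (T - t) :=
      hφ.eventually_lt_const (lt_min hs.1 (by linarith [ht.2]))
    filter_upwards [hsm] with n hn
    have hn1 := hn.trans_le (min_le_left _ _)
    have hn2 := hn.trans_le (min_le_right _ _)
    refine le_of_tendsto_of_tendsto' (hconv n s) (hconv n t) fun k => ?_
    -- substitute, so that both integrals run over the support of the bump
    have key : ∀ r, r ∈ Icc s t → ∫ τ in (0 : ℝ)..T, (φ n).normed volume (r - τ) * w k τ =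
        ∫ y in (-(φ n).rOut)..(φ n).rOut, (φ n).normed volume y * w k (r - y) := by
      intro r hr
      have h1 := intervalIntegral.integral_comp_sub_left (a := 0) (b := T)
        (fun y => (φ n).normed volume y * w k (r - y)) r
      simp only [sub_sub_cancel] at h1
      rw [h1]
      have hsupp : Function.support (fun y => (φ n).normed volume y * w k (r - y)) ⊆
          Ioc (-(φ n).rOut) (φ n).rOut := by
        intro y hy
        have : y ∈ Function.support ((φ n).normed volume) := by
          intro h0; exact hy (by simp [h0])
        rw [(φ n).support_normed_eq, mem_ball_zero_iff, Real.norm_eq_abs, abs_lt] at this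
        exact ⟨this.1, this.2.le⟩
      have hr1 := hr.1
      have hr2 := hr.2
      rw [intervalIntegral.integral_eq_integral_of_support_subset hsupp,
        intervalIntegral.integral_eq_integral_of_support_subset]
      refine hsupp.trans (Ioc_subset_Ioc ?_ ?_) <;> linarith
    rw [key s ⟨le_rfl, hst⟩, key t ⟨hst, le_rfl⟩]
    have hpos := (φ n).rOut_pos
    have hint : ∀ r, r ∈ Icc s t → IntervalIntegrable
        (fun y => (φ n).normed volume y * w k (r - y)) volume (-(φ n).rOut) (φ n).rOut := by
      intro r hr
      have hanti : AntitoneOn (fun y => w k (r - y)) (uIcc (-(φ n).rOut) (φ n).rOut) := by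
        rw [uIcc_of_le (by linarith)]
        intro a ha b hb hab
        exact hw k ⟨by linarith [hb.2, hr.1], by linarith [hb.1, hr.2]⟩
          ⟨by linarith [ha.2, hr.1], by linarith [ha.1, hr.2]⟩ (by linarith)
      exact hanti.intervalIntegrable.continuousOn_mul (φ n).continuous_normed.continuousOn
    refine intervalIntegral.integral_mono_on (by linarith) (hint s ⟨le_rfl, hst⟩)
      (hint t ⟨hst, le_rfl⟩) fun y hy => ?_
    refine mul_le_mul_of_nonneg_left (hw k ?_ ?_ (by linarith)) ((φ n).nonneg_normed y)
    · exact ⟨by linarith [hy.2], by linarith [hy.1, ht.2]⟩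
    · exact ⟨by linarith [hy.2], by linarith [hy.1, ht.2]⟩

/-! ### A priori estimates for the particle system -/

section Particles

variable {d N : ℕ} {p α T M : ℝ} {x v : Fin N → ℝ → E d}

/-- Maximum principle for the velocities: each force on a fastest particle points inwards. -/
theorem IsParticleSolution.norm_velocity_le (hs : IsParticleSolution p α T x v) (hM : 0 ≤ M)
    (hv : ∀ i, ‖v i 0‖ ≤ M) {t : ℝ} (ht : t ∈ Icc 0 T) (i : Fin N) : ‖v i t‖ ≤ M := by
  have key : ∀ ε > 0, ∀ t ∈ Icc 0 T, ∀ i, ‖v i t‖ ^ 2 ≤ M ^ 2 + ε * t := by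
    intro ε hε
    have hcont : ∀ i, ContinuousOn (fun t => ‖v i t‖ ^ 2) (Icc 0 T) := fun i =>
      (ContinuousOn.norm fun t ht => (hs.deriv_velocity i t ht).continuousWithinAt).pow 2
    have hclosed : IsClosed ({t | ∀ i, ‖v i t‖ ^ 2 ≤ M ^ 2 + ε * t} ∩ Icc 0 T) := by
      have : {t | ∀ i, ‖v i t‖ ^ 2 ≤ M ^ 2 + ε * t} ∩ Icc 0 T =
          Icc 0 T ∩ ⋂ i, {t ∈ Icc 0 T | ‖v i t‖ ^ 2 ≤ M ^ 2 + ε * t} := by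
        ext t
        simp only [mem_inter_iff, mem_ofPred_eq, mem_iInter]
        exact ⟨fun h => ⟨h.2, fun i => ⟨h.2, h.1 i⟩⟩, fun h => ⟨fun i => (h.2 i).2, h.1⟩⟩
      rw [this]
      exact isClosed_Icc.inter (isClosed_iInter fun i =>
        isClosed_Icc.isClosed_le (hcont i) (by fun_prop))
    refine fun t ht => hclosed.Icc_subset_of_forall_exists_gt ?_ ?_ ht
    · intro i
      simpa using pow_le_pow_left₀ (norm_nonneg _) (hv i) 2
    rintro t ⟨hts, ht0, htT⟩ y hy
    have htI : t ∈ Icc 0 T := ⟨ht0, htT.le⟩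
    have hnhds : 𝓝[>] t ≤ 𝓝[Icc 0 T] t :=
      nhdsWithin_le_of_mem (mem_of_superset (Ioo_mem_nhdsGT htT)
        fun τ hτ => ⟨ht0.trans hτ.1.le, hτ.2.le⟩)
    have hev : ∀ᶠ τ in 𝓝[>] t, ∀ i, ‖v i τ‖ ^ 2 ≤ M ^ 2 + ε * τ := by
      rw [eventually_all]
      intro i
      rcases (hts i).lt_or_eq with hlt | heq
      · have h1 : Tendsto (fun τ => ‖v i τ‖ ^ 2) (𝓝[>] t) (𝓝 (‖v i t‖ ^ 2)) :=
          (hcont i t htI).mono_left hnhds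
        have h2 : Tendsto (fun τ => M ^ 2 + ε * τ) (𝓝[>] t) (𝓝 (M ^ 2 + ε * t)) :=
          Continuous.continuousWithinAt (by fun_prop)
        exact (h1.eventually_lt h2 hlt).mono fun _ h => h.le
      · -- the speed of a fastest particle does not grow
        have hd := (hs.deriv_velocity i t htI).norm_sq.mono_of_mem_nhdsWithin
          (s := Ioi t) (hnhds self_mem_nhdsWithin)
        have hle : 2 * inner ℝ (v i t) ((N : ℝ)⁻¹ • ∑ j ∈ Finset.univ.erase i,
            (‖v j t - v i t‖ ^ (p - 2) / ‖x i t - x j t‖ ^ α) • (v j t - v i t)) ≤ 0 := by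
          rw [inner_smul_right, inner_sum]
          have : ∑ j ∈ Finset.univ.erase i, inner ℝ (v i t)
              ((‖v j t - v i t‖ ^ (p - 2) / ‖x i t - x j t‖ ^ α) • (v j t - v i t)) ≤ 0 := by
            refine Finset.sum_nonpos fun j _ => ?_
            rw [inner_smul_right, inner_sub_right, real_inner_self_eq_norm_sq]
            refine mul_nonpos_of_nonneg_of_nonpos (by positivity) ?_
            have h1 : ‖v j t‖ ≤ ‖v i t‖ := by
              have := hts j
              rw [← heq] at this
              exact (sq_le_sq₀ (norm_nonneg _) (norm_nonneg _)).1 this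
            have h2 := real_inner_le_norm (v i t) (v j t)
            nlinarith [norm_nonneg (v i t)]
          have h3 : (0 : ℝ) ≤ (N : ℝ)⁻¹ := by positivity
          nlinarith [mul_nonpos_of_nonneg_of_nonpos h3 this]
        have hsl := (hasDerivWithinAt_iff_tendsto_slope' self_notMem_Ioi).1 hd
        filter_upwards [hsl.eventually_lt_const (hle.trans_lt hε), self_mem_nhdsWithin]
          with τ hτ htτ
        have htτ' : t < τ := htτ
        rw [slope_def_field, div_lt_iff₀ (by linarith)] at hτ
        linarith
    obtain ⟨τ, h1, h2⟩ := (hev.and (Ioc_mem_nhdsGT hy)).exists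
    exact ⟨τ, h1, h2⟩
  -- let `ε` tend to zero, uniformly for times up to `T`
  have hle : ‖v i t‖ ^ 2 ≤ M ^ 2 := by
    refine le_of_forall_pos_le_add fun ε hε => ?_
    have hT : 0 < T + 1 := by linarith [ht.1, ht.2]
    have h1 := key (ε / (T + 1)) (by positivity) t ht i
    have h2 : ε / (T + 1) * t ≤ ε := by
      rw [div_mul_eq_mul_div, div_le_iff₀ hT]
      nlinarith [ht.1, ht.2]
    linarith
  exact (sq_le_sq₀ (norm_nonneg _) hM).1 hle

theorem IsParticleSolution.norm_position_sub_le (hs : IsParticleSolution p α T x v) (hM : 0 ≤ M)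
    (hv : ∀ i, ‖v i 0‖ ≤ M) {s t : ℝ} (hs0 : 0 ≤ s) (hst : s ≤ t) (htT : t ≤ T) (i : Fin N) :
    ‖x i t - x i s‖ ≤ M * (t - s) := by
  have h := (convex_Icc 0 T).norm_image_sub_le_of_norm_hasDerivWithin_le (f := x i)
    (hs.deriv_position i) (fun τ hτ => hs.norm_velocity_le hM hv hτ i)
    (x := s) (y := t) ⟨hs0, hst.trans htT⟩ ⟨hs0.trans hst, htT⟩
  rwa [Real.norm_of_nonneg (by linarith)] at h

theorem IsParticleSolution.norm_position_le (hs : IsParticleSolution p α T x v) (hM : 0 ≤ M)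
    (hx : ∀ i, ‖x i 0‖ ≤ M) (hv : ∀ i, ‖v i 0‖ ≤ M) {t : ℝ} (ht : t ∈ Icc 0 T) (i : Fin N) :
    ‖x i t‖ ≤ (T + 1) * M := by
  have h1 := hs.norm_position_sub_le hM hv le_rfl ht.1 ht.2 i
  have h2 := norm_le_insert' (x i t) (x i 0)
  have h3 := hx i
  have h4 : M * (t - 0) ≤ M * T := by
    rw [sub_zero]; exact mul_le_mul_of_nonneg_left ht.2 hM
  linarith

/-- Exchanging `i` and `j` turns a sum of pairwise alignment forces into one that involves only the
differences `A j - A i`. -/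
theorem sum_symmetrize {V : Type*} [NormedAddCommGroup V] [NormedSpace ℝ V] {w : Fin N → Fin N → ℝ}
    (hw : ∀ i j, w i j = w j i) (A : Fin N → V →L[ℝ] ℝ) (u : Fin N → V) :
    ∑ i, A i (∑ j ∈ Finset.univ.erase i, w i j • (u j - u i)) =
      -(1 / 2) * ∑ i, ∑ j, w i j * (A j - A i) (u j - u i) := by
  have h1 : ∀ i, A i (∑ j ∈ Finset.univ.erase i, w i j • (u j - u i)) =
      ∑ j, w i j * A i (u j - u i) := by
    intro i
    rw [Finset.sum_erase _ (by simp), map_sum]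
    simp
  have h2 : ∑ i, ∑ j, w i j * A i (u j - u i) = -∑ i, ∑ j, w i j * A j (u j - u i) := by
    rw [Finset.sum_comm, ← Finset.sum_neg_distrib]
    refine Finset.sum_congr rfl fun i _ => ?_
    rw [← Finset.sum_neg_distrib]
    refine Finset.sum_congr rfl fun j _ => ?_
    rw [hw, ← neg_sub (u j), map_neg, mul_neg]
  have h3 : ∑ i, ∑ j, w i j * (A j - A i) (u j - u i) =
      ∑ i, ∑ j, w i j * A j (u j - u i) - ∑ i, ∑ j, w i j * A i (u j - u i) := by
    simp only [← Finset.sum_sub_distrib, sub_apply, mul_sub]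
  rw [Finset.sum_congr rfl fun i _ => h1 i, h3]
  linarith

/-- The bound that controls the singularity for `α ≤ p`.  With `a` the relative speed and `b` the
distance, either `b ≤ a` and the left side is part of the dissipation, or `a ≤ b` and the left side
is at most `a ^ (p - 1) * b ^ (1 - α) ≤ b ^ (p - α)`. -/
theorem rpow_div_mul_max_mul_le {a b B : ℝ} (hp : 1 ≤ p) (hαp : α ≤ p) (ha : 0 ≤ a) (hb : 0 < b)
    (hbB : b ≤ B) :
    a ^ (p - 2) / b ^ α * (max b a * a) ≤ a ^ (p - 2) / b ^ α * a ^ 2 + B ^ (p - α) := by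
  have hB : 0 < B := hb.trans_le hbB
  have hnn : 0 ≤ a ^ (p - 2) / b ^ α := by positivity
  rcases ha.eq_or_lt with rfl | ha
  · simp only [mul_zero, ne_eq, OfNat.ofNat_ne_zero, not_false_eq_true, zero_pow, zero_add]
    positivity
  rcases le_total b a with hba | hab
  · rw [max_eq_right hba, ← sq]
    exact le_add_of_nonneg_right (by positivity)
  · rw [max_eq_left hab]
    have h1 : a ^ (p - 2) * a = a ^ (p - 1) := by
      rw [← Real.rpow_add_one ha.ne']; congr 1; ring
    have h2 : b ^ (p - 1) * b = b ^ (p - α) * b ^ α := by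
      rw [← Real.rpow_add_one hb.ne', ← Real.rpow_add hb]; congr 1; ring
    have h3 : a ^ (p - 2) / b ^ α * (b * a) ≤ b ^ (p - α) := by
      have hbα : 0 < b ^ α := by positivity
      rw [div_mul_eq_mul_div, div_le_iff₀ hbα, ← h2, mul_comm b a, ← mul_assoc, h1]
      exact mul_le_mul_of_nonneg_right (Real.rpow_le_rpow ha.le hab (by linarith)) hb.le
    have h4 : b ^ (p - α) ≤ B ^ (p - α) := Real.rpow_le_rpow hb.le hbB (by linarith)
    have h5 : 0 ≤ a ^ (p - 2) / b ^ α * a ^ 2 := by positivity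
    linarith

/-- The function `t - (1/N) ∑_i |v_i(t)|²`.  It increases at the rate `1 + D(t)`, where `D` is the
dissipation `(1/N²) ∑_{i,j} |v_j - v_i|^p / |x_i - x_j|^α`. -/
noncomputable def clock (v : Fin N → ℝ → E d) (t : ℝ) : ℝ := t - (N : ℝ)⁻¹ * ∑ i, ‖v i t‖ ^ 2

/-- The rate of change of any smooth observable is bounded by a multiple of `1 + D`, the growth rate
of `clock`; the constant depends on neither the number of particles nor the solution. -/
theorem exists_monotoneOn_clock_add (hp : 1 ≤ p) (hαp : α ≤ p) (hM : 0 ≤ M) (T : ℝ)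
    {g : E d × E d → ℝ} (hg : ContDiff ℝ ∞ g) (hgc : HasCompactSupport g) :
    ∃ C, 0 < C ∧ ∀ {N : ℕ} {x v : Fin N → ℝ → E d}, 0 < N → IsParticleSolution p α T x v →
      (∀ i, ‖x i 0‖ ≤ M) → (∀ i, ‖v i 0‖ ≤ M) →
      MonotoneOn (fun t => C * clock v t + (N : ℝ)⁻¹ * ∑ i, g (x i t, v i t)) (Icc 0 T) := by
  obtain ⟨L₀, hL₀⟩ := (hgc.fderiv ℝ).exists_bound_of_continuous (hg.continuous_fderiv (by simp))
  obtain ⟨L, hL⟩ := (hg.fderiv_right (m := ∞) (by simp)).lipschitzWith_of_hasCompactSupport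
    (hgc.fderiv ℝ) (by simp)
  have hL₀' : 0 ≤ L₀ := (norm_nonneg _).trans (hL₀ 0)
  set P : ℝ := (2 * ((T + 1) * M)) ^ (p - α) with hP
  by_cases hT : 0 ≤ T
  swap
  · refine ⟨1, one_pos, ?_⟩
    intro N x v _ _ _ _
    rw [Icc_eq_empty hT]
    exact fun _ h => absurd h (notMem_empty _)
  have hP0 : 0 ≤ P := by positivity
  -- `L₀ * M` bounds the transport, `L / 2` and `L / 2 * P` the symmetrized force;
  -- `1` makes the constant positive
  refine ⟨L₀ * M + L / 2 + L / 2 * P + 1, by positivity, ?_⟩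
  intro N x v hN hs hx hv
  set C : ℝ := L₀ * M + L / 2 + L / 2 * P + 1 with hC
  have hC0 : 0 ≤ C := by positivity
  have hN' : (0 : ℝ) < N := by exact_mod_cast hN
  set w : ℝ → Fin N → Fin N → ℝ :=
    fun t i j => ‖v j t - v i t‖ ^ (p - 2) / ‖x i t - x j t‖ ^ α with hw
  have hwnn : ∀ t i j, 0 ≤ w t i j := fun t i j => by simp only [hw]; positivity
  have hwsymm : ∀ t i j, w t i j = w t j i := fun t i j => by
    simp only [hw]; rw [norm_sub_rev, norm_sub_rev (x i t)]
  set a : ℝ → Fin N → E d := fun t i =>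
    (N : ℝ)⁻¹ • ∑ j ∈ Finset.univ.erase i, w t i j • (v j t - v i t) with ha
  have hda : ∀ i, ∀ t ∈ Icc 0 T, HasDerivWithinAt (v i) (a t i) (Icc 0 T) t := hs.deriv_velocity
  -- the mean squared speed decreases at the rate `D`
  set D : ℝ → ℝ := fun t =>
    (N : ℝ)⁻¹ * ((N : ℝ)⁻¹ * ∑ i, ∑ j, w t i j * ‖v j t - v i t‖ ^ 2) with hD
  have hD0 : ∀ t, 0 ≤ D t := fun t => by
    have : 0 ≤ ∑ i, ∑ j, w t i j * ‖v j t - v i t‖ ^ 2 :=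
      Finset.sum_nonneg fun i _ => Finset.sum_nonneg fun j _ =>
        mul_nonneg (hwnn t i j) (by positivity)
    simp only [hD]; positivity
  have hdE : ∀ t ∈ Icc 0 T, HasDerivWithinAt (clock v) (1 + D t) (Icc 0 T) t := by
    intro t ht
    have h1 : HasDerivWithinAt (fun t => (N : ℝ)⁻¹ * ∑ i, ‖v i t‖ ^ 2)
        ((N : ℝ)⁻¹ * ∑ i, 2 * inner ℝ (v i t) (a t i)) (Icc 0 T) t :=
      (HasDerivWithinAt.fun_sum fun i _ => (hda i t ht).norm_sq).const_mul _
    have h2 := (hasDerivWithinAt_id t (Icc 0 T)).sub h1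
    refine h2.congr_deriv ?_
    have h3 := sum_symmetrize (hwsymm t) (fun i => innerSL ℝ (v i t)) (fun i => v i t)
    simp only [← map_sub, innerSL_apply_apply, real_inner_self_eq_norm_sq] at h3
    have h4 : ∑ i, 2 * inner ℝ (v i t) (a t i) =
        (N : ℝ)⁻¹ * (2 * ∑ i, inner ℝ (v i t)
          (∑ j ∈ Finset.univ.erase i, w t i j • (v j t - v i t))) := by
      simp only [Finset.mul_sum, ha, inner_smul_right]
      refine Finset.sum_congr rfl fun i _ => by ring
    rw [h4, h3]
    simp only [hD]
    ring
  have hdg : ∀ t ∈ Icc 0 T, HasDerivWithinAt (fun t => (N : ℝ)⁻¹ * ∑ i, g (x i t, v i t))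
      ((N : ℝ)⁻¹ * ∑ i, fderiv ℝ g (x i t, v i t) (v i t, a t i)) (Icc 0 T) t := by
    intro t ht
    refine (HasDerivWithinAt.fun_sum fun i _ => ?_).const_mul _
    exact ((hg.differentiable (by simp) _).hasFDerivAt).comp_hasDerivWithinAt t
      ((hs.deriv_position i t ht).prodMk (hda i t ht))
  have hbound : ∀ t ∈ Icc 0 T,
      -(C * (1 + D t)) ≤ (N : ℝ)⁻¹ * ∑ i, fderiv ℝ g (x i t, v i t) (v i t, a t i) := by
    intro t ht
    set A : Fin N → E d →L[ℝ] ℝ := fun i =>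
      (fderiv ℝ g (x i t, v i t)).comp (ContinuousLinearMap.inr ℝ (E d) (E d)) with hA
    -- transport and force parts; only the latter is singular
    have hsplit : ∑ i, fderiv ℝ g (x i t, v i t) (v i t, a t i) =
        ∑ i, fderiv ℝ g (x i t, v i t) (v i t, 0) + (N : ℝ)⁻¹ *
          ∑ i, A i (∑ j ∈ Finset.univ.erase i, w t i j • (v j t - v i t)) := by
      rw [Finset.mul_sum, ← Finset.sum_add_distrib]
      refine Finset.sum_congr rfl fun i _ => ?_
      have : (v i t, a t i) = (v i t, 0) + (0, a t i) := by simp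
      rw [this, map_add]
      simp only [hA, ha, ← smul_eq_mul, ← map_smul]
      rfl
    have h1 : -(N * (L₀ * M)) ≤ ∑ i, fderiv ℝ g (x i t, v i t) (v i t, 0) := by
      have : ∑ i : Fin N, -(L₀ * M) ≤ ∑ i, fderiv ℝ g (x i t, v i t) (v i t, 0) := by
        refine Finset.sum_le_sum fun i _ => neg_le_of_abs_le ?_
        rw [← Real.norm_eq_abs]
        refine (ContinuousLinearMap.le_of_opNorm_le _ (hL₀ _) _).trans ?_
        refine mul_le_mul_of_nonneg_left ?_ hL₀'
        simpa [Prod.norm_def, hM] using hs.norm_velocity_le hM hv ht i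
      simpa using this
    have h2 : ∑ i, ∑ j, w t i j * (A j - A i) (v j t - v i t) ≤
        ∑ i, ∑ j, L * (w t i j * ‖v j t - v i t‖ ^ 2 + P) := by
      refine Finset.sum_le_sum fun i _ => Finset.sum_le_sum fun j _ => ?_
      rcases eq_or_ne i j with rfl | hij
      · simp only [sub_self, map_zero, mul_zero, norm_zero]
        have := hwnn t i i
        positivity
      have hb : 0 < ‖x i t - x j t‖ :=
        norm_pos_iff.2 (sub_ne_zero.2 (hs.noncollisional i j hij t ht))
      have hbB : ‖x i t - x j t‖ ≤ 2 * ((T + 1) * M) := by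
        have := norm_sub_le (x i t) (x j t)
        have := hs.norm_position_le hM hx hv ht i
        have := hs.norm_position_le hM hx hv ht j
        linarith
      have hAop : ‖A j - A i‖ ≤ L * max ‖x i t - x j t‖ ‖v j t - v i t‖ := by
        have h3 := hL.dist_le_mul (x j t, v j t) (x i t, v i t)
        rw [dist_eq_norm, dist_eq_norm] at h3
        have h4 : A j - A i = (fderiv ℝ g (x j t, v j t) - fderiv ℝ g (x i t, v i t)).comp
            (ContinuousLinearMap.inr ℝ (E d) (E d)) := by
          simp only [hA, ContinuousLinearMap.sub_comp]
        rw [h4]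
        refine ((ContinuousLinearMap.opNorm_comp_le _ _).trans
          (mul_le_of_le_one_right (norm_nonneg _)
            (ContinuousLinearMap.norm_inr_le_one ℝ (E d) (E d)))).trans (h3.trans_eq ?_)
        rw [Prod.mk_sub_mk, Prod.norm_def, norm_sub_rev (x j t)]
      calc w t i j * (A j - A i) (v j t - v i t)
          ≤ w t i j * (L * max ‖x i t - x j t‖ ‖v j t - v i t‖ * ‖v j t - v i t‖) := by
            refine mul_le_mul_of_nonneg_left ?_ (hwnn t i j)
            exact (le_abs_self _).trans (ContinuousLinearMap.le_of_opNorm_le _ hAop _)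
        _ = L * (w t i j * (max ‖x i t - x j t‖ ‖v j t - v i t‖ * ‖v j t - v i t‖)) := by ring
        _ ≤ L * (w t i j * ‖v j t - v i t‖ ^ 2 + P) :=
            mul_le_mul_of_nonneg_left
              (rpow_div_mul_max_mul_le hp hαp (norm_nonneg _) hb hbB) L.2
    have h3 : ∑ i : Fin N, ∑ j : Fin N, L * (w t i j * ‖v j t - v i t‖ ^ 2 + P) =
        L * (N * (N * D t) + N * (N * P)) := by
      simp only [← Finset.mul_sum, Finset.sum_add_distrib, Finset.sum_const, Finset.card_univ,
        Fintype.card_fin, nsmul_eq_mul, hD]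
      field_simp
    rw [hsplit, sum_symmetrize (hwsymm t)]
    rw [h3] at h2
    have h4 : (N : ℝ)⁻¹ * (-(N * (L₀ * M)) + (N : ℝ)⁻¹ * (-(1 / 2) *
        (L * (N * (N * D t) + N * (N * P))))) = -(L₀ * M) - L / 2 * (D t + P) := by
      field_simp
      ring
    have h5 : -(C * (1 + D t)) ≤ -(L₀ * M) - L / 2 * (D t + P) := by
      have := hD0 t
      have h6 : 0 ≤ (L₀ * M) * D t := by positivity
      have h7 : 0 ≤ (L / 2 * P) * D t := by positivity
      have h8 : (0 : ℝ) ≤ L := L.2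
      simp only [hC]
      nlinarith
    rw [← h4] at h5
    refine h5.trans (mul_le_mul_of_nonneg_left (add_le_add h1
      (mul_le_mul_of_nonneg_left ?_ (by positivity))) (by positivity))
    linarith
  have hder : ∀ t ∈ Icc 0 T, HasDerivWithinAt
      (fun t => C * clock v t + (N : ℝ)⁻¹ * ∑ i, g (x i t, v i t))
      (C * (1 + D t) + (N : ℝ)⁻¹ * ∑ i, fderiv ℝ g (x i t, v i t) (v i t, a t i)) (Icc 0 T) t :=
    fun t ht => ((hdE t ht).const_mul C).add (hdg t ht)
  refine monotoneOn_of_hasDerivWithinAt_nonneg (convex_Icc 0 T)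
    (fun t ht => (hder t ht).continuousWithinAt)
    (fun t ht => (hder t (interior_subset ht)).mono interior_subset) fun t ht => ?_
  linarith [hbound t (interior_subset ht)]

end Particles

/-! ### Integrals of continuous functions against compactly supported measures and kernels -/

section Integrals

theorem integrable_of_continuous_of_compact_support {X : Type*} [TopologicalSpace X] [T2Space X]
    [MeasurableSpace X] [BorelSpace X] {ν : Measure X} [IsFiniteMeasure ν]
    {K : Set X} (hK : IsCompact K) (hν : ν Kᶜ = 0) {f : X → ℝ} (hf : Continuous f) :
    Integrable f ν := by
  have h := hf.continuousOn.integrableOn_compact (μ := ν) hK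
  rwa [IntegrableOn, Measure.restrict_eq_self_of_ae_mem (mem_ae_iff.2 hν)] at h

theorem abs_integral_sub_integral_le {X : Type*} [TopologicalSpace X] [T2Space X]
    [MeasurableSpace X] [BorelSpace X] {ν : Measure X} [IsProbabilityMeasure ν]
    {K : Set X} (hK : IsCompact K) (hν : ν Kᶜ = 0) {f g : X → ℝ} (hf : Continuous f)
    (hg : Continuous g) {ε : ℝ} (h : ∀ z ∈ K, |f z - g z| ≤ ε) :
    |∫ z, f z ∂ν - ∫ z, g z ∂ν| ≤ ε := by
  rw [← integral_sub (integrable_of_continuous_of_compact_support hK hν hf)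
    (integrable_of_continuous_of_compact_support hK hν hg), ← Real.norm_eq_abs]
  refine (norm_integral_le_of_norm_le_const (C := ε) ?_).trans (by simp)
  have : ∀ᵐ z ∂ν, z ∈ K := mem_ae_iff.2 hν
  exact this.mono fun z hz => h z hz

/-- The distance to `K`, truncated at `1`; its integral vanishes only for measures carried by the
closure of `K`. -/
noncomputable def truncDist {X : Type*} [PseudoMetricSpace X] (K : Set X) : X →ᵇ ℝ :=
  BoundedContinuousFunction.ofNormedAddCommGroup (fun z => min (Metric.infDist z K) 1)
    ((Metric.continuous_infDist_pt K).min continuous_const) 1 fun z => by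
      rw [Real.norm_of_nonneg (le_min Metric.infDist_nonneg zero_le_one)]
      exact min_le_right _ _

theorem truncDist_nonneg {X : Type*} [PseudoMetricSpace X] (K : Set X) (z : X) :
    0 ≤ truncDist K z :=
  le_min Metric.infDist_nonneg zero_le_one

theorem measure_compl_eq_zero_of_integral_truncDist {X : Type*} [PseudoMetricSpace X]
    [MeasurableSpace X] [BorelSpace X] {ν : Measure X} [IsFiniteMeasure ν]
    {K : Set X} (hK : IsClosed K) (hne : K.Nonempty) (h : ∫ z, truncDist K z ∂ν = 0) :
    ν Kᶜ = 0 := by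
  rw [integral_eq_zero_iff_of_nonneg (truncDist_nonneg K) ((truncDist K).integrable ν)] at h
  have hmem : ∀ᵐ z ∂ν, z ∈ K := h.mono fun z h1 => by
    have h2 : min (Metric.infDist z K) 1 = 0 := h1
    rw [hK.mem_iff_infDist_zero hne]
    rcases min_choice (Metric.infDist z K) 1 with h3 | h3 <;> rw [h3] at h2
    · exact h2
    · norm_num at h2
  exact mem_ae_iff.1 hmem

theorem intervalIntegrable_integral_kernel {X : Type*} [TopologicalSpace X] [MeasurableSpace X]
    [Nonempty X] [OpensMeasurableSpace X] {T : ℝ} (hT : 0 ≤ T) {μ : ProbabilityTheory.Kernel ℝ X}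
    (hμ : ∀ t ∈ Icc 0 T, IsProbabilityMeasure (μ t)) (f : X →ᵇ ℝ) :
    IntervalIntegrable (fun t => ∫ z, f z ∂(μ t)) volume 0 T := by
  classical
  -- outside `[0,T]` the kernel need not be finite, so replace it there by a Dirac mass
  let κ := ProbabilityTheory.Kernel.piecewise (measurableSet_Icc (a := 0) (b := T)) μ
    (ProbabilityTheory.Kernel.const ℝ (Measure.dirac (Classical.arbitrary X)))
  have hκ : ∀ t, t ∈ Icc 0 T → κ t = μ t := fun t ht => by
    simp only [κ, ProbabilityTheory.Kernel.piecewise_apply, if_pos ht]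
  have : ProbabilityTheory.IsMarkovKernel κ := ⟨fun t => by
    by_cases ht : t ∈ Icc 0 T
    · rw [hκ t ht]; exact hμ t ht
    · simp only [κ, ProbabilityTheory.Kernel.piecewise_apply, if_neg ht]
      infer_instance⟩
  have hmeas : StronglyMeasurable fun t => ∫ z, f z ∂(κ t) :=
    StronglyMeasurable.integral_kernel f.continuous.measurable.stronglyMeasurable
  rw [intervalIntegrable_iff_integrableOn_Icc_of_le hT]
  have h1 : IntegrableOn (fun t => ∫ z, f z ∂(κ t)) (Icc 0 T) :=
    Integrable.of_bound hmeas.aestronglyMeasurable ‖f‖ (Eventually.of_forall fun t =>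
      f.norm_integral_le_norm (κ t))
  exact h1.congr_fun (fun t ht => by simp only [hκ t ht]) measurableSet_Icc

end Integrals

/-! ### Atomic measures and the bounded-Lipschitz distance -/

section Atomic

variable {d N : ℕ} {p α T M : ℝ} {x v : Fin N → ℝ → E d}

theorem isProbabilityMeasure_atomic (hN : 0 < N) (x v : Fin N → ℝ → E d) (t : ℝ) :
    IsProbabilityMeasure (atomic x v t) := ⟨by
  have h0 : (N : ℝ≥0∞) ≠ 0 := by exact_mod_cast hN.ne'
  simp [atomic, ENNReal.inv_mul_cancel h0 (ENNReal.natCast_ne_top N)]⟩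

theorem integral_atomic (x v : Fin N → ℝ → E d) (t : ℝ) (f : E d × E d → ℝ) :
    ∫ z, f z ∂(atomic x v t) = (N : ℝ)⁻¹ * ∑ i, f (x i t, v i t) := by
  rw [atomic, integral_smul_measure, integral_finsetSum_measure fun i _ =>
    integrable_dirac (by simp)]
  simp

theorem integral_fst_atomic (x v : Fin N → ℝ → E d) (t : ℝ) {f : E d → ℝ} (hf : Continuous f) :
    ∫ y, f y ∂(atomic x v t).fst = (N : ℝ)⁻¹ * ∑ i, f (x i t) := by
  rw [Measure.fst, integral_map measurable_fst.aemeasurable hf.aestronglyMeasurable,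
    integral_atomic]

theorem abs_integral_sub_le_dBL {μ ν : Measure (E d)} {f : E d → ℝ} (hf : ∀ y, |f y| ≤ 1)
    (hf' : LipschitzWith 1 f) :
    ENNReal.ofReal |∫ y, f y ∂μ - ∫ y, f y ∂ν| ≤ dBL μ ν :=
  le_iSup (fun f : {f : E d → ℝ // (∀ x, |f x| ≤ 1) ∧ LipschitzWith 1 f} =>
    ENNReal.ofReal |∫ x, f.1 x ∂μ - ∫ x, f.1 x ∂ν|) ⟨f, hf, hf'⟩

/-- Convergence in `d_BL` gives convergence of the integrals of all bounded Lipschitz functions, by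
scaling to bound and Lipschitz constant `1`. -/
theorem tendsto_integral_of_tendsto_dBL {m : ℕ → Measure (E d)} {ν : Measure (E d)}
    (h : ∀ ε : ℝ≥0∞, 0 < ε → ∀ᶠ k in atTop, dBL (m k) ν ≤ ε) {f : E d → ℝ} {B : ℝ}
    {L : NNReal} (hf : ∀ y, |f y| ≤ B) (hf' : LipschitzWith L f) :
    Tendsto (fun k => ∫ y, f y ∂(m k)) atTop (𝓝 (∫ y, f y ∂ν)) := by
  set c : ℝ := max (max B L) 1 with hc
  have hc0 : 0 < c := lt_max_of_lt_right one_pos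
  have h1 : ∀ y, |c⁻¹ * f y| ≤ 1 := fun y => by
    rw [abs_mul, abs_of_pos (inv_pos.2 hc0), inv_mul_le_iff₀ hc0, mul_one]
    exact (hf y).trans ((le_max_left _ _).trans (le_max_left _ _))
  have h2 : LipschitzWith 1 fun y => c⁻¹ * f y := LipschitzWith.of_dist_le_mul fun y z => by
    rw [Real.dist_eq, ← mul_sub, abs_mul, abs_of_pos (inv_pos.2 hc0), inv_mul_le_iff₀ hc0,
      ← Real.dist_eq, NNReal.coe_one, one_mul]
    exact (hf'.dist_le_mul y z).trans (mul_le_mul_of_nonneg_right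
      ((le_max_right _ _).trans (le_max_left _ _)) dist_nonneg)
  rw [Metric.tendsto_atTop']
  intro ε hε
  have h3 : 0 < ENNReal.ofReal (ε / 2 / c) := by simpa using by positivity
  obtain ⟨K, hK⟩ := eventually_atTop.1 (h _ h3)
  refine ⟨K, fun k hk => ?_⟩
  have h4 := (abs_integral_sub_le_dBL (μ := m k) (ν := ν) h1 h2).trans (hK k hk.le)
  rw [ENNReal.ofReal_le_ofReal_iff (by positivity), integral_const_mul, integral_const_mul,
    ← mul_sub, abs_mul, abs_of_pos (inv_pos.2 hc0), inv_mul_le_iff₀ hc0,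
    mul_div_cancel₀ _ hc0.ne'] at h4
  rw [Real.dist_eq]
  linarith

end Atomic

/-! ### Support and spatial density of the limit -/

/-- The phase box `(T+1) B(M) × B(M)`, which contains all particle states up to time `T`. -/
def phaseBox (d : ℕ) (T M : ℝ) : Set (E d × E d) :=
  Metric.closedBall 0 ((T + 1) * M) ×ˢ Metric.closedBall 0 M

theorem isCompact_phaseBox (d : ℕ) (T M : ℝ) : IsCompact (phaseBox d T M) :=
  (isCompact_closedBall _ _).prod (isCompact_closedBall _ _)

variable {d : ℕ} {p α T M : ℝ} {ρ₀ : Measure (E d)} {u₀ : E d → E d}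
  {N : ℕ → ℕ} {x v : ∀ k, Fin (N k) → ℝ → E d}
  {μ : ProbabilityTheory.Kernel ℝ (E d × E d)} {ρ : ℝ → Measure (E d)}

namespace IsLimitFamily

theorem mem_phaseBox (h : IsLimitFamily p α T M ρ₀ u₀ N x v μ ρ) (hM : 0 ≤ M) (k : ℕ)
    (i : Fin (N k)) {t : ℝ} (ht : t ∈ Icc 0 T) : (x k i t, v k i t) ∈ phaseBox d T M :=
  ⟨mem_closedBall_zero_iff.2
    ((h.solution k).norm_position_le hM (h.bound_position k) (h.bound_velocity k) ht i),
  mem_closedBall_zero_iff.2 ((h.solution k).norm_velocity_le hM (h.bound_velocity k) ht i)⟩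

theorem ae_measure_compl_phaseBox (h : IsLimitFamily p α T M ρ₀ u₀ N x v μ ρ) (hM : 0 ≤ M)
    (hT : 0 ≤ T) : ∀ᵐ t ∂(volume.restrict (Icc 0 T)), μ t (phaseBox d T M)ᶜ = 0 := by
  have hne : (phaseBox d T M).Nonempty := ⟨0, by
    simp only [phaseBox, mem_prod, Prod.fst_zero, Prod.snd_zero, Metric.mem_closedBall, dist_self]
    exact ⟨by positivity, hM⟩⟩
  have h1 := h.tendsto_limit
    ((truncDist (phaseBox d T M)).compContinuous ⟨Prod.snd, continuous_snd⟩)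
  have h2 : ∀ k, ∫ t in (0 : ℝ)..T, ∫ z, truncDist (phaseBox d T M) z ∂(atomic (x k) (v k) t)
      = 0 := by
    intro k
    refine (intervalIntegral.integral_congr (g := fun _ => 0) fun t ht => ?_).trans (by simp)
    rw [uIcc_of_le hT] at ht
    simp only [integral_atomic]
    rw [Finset.sum_eq_zero, mul_zero]
    intro i _
    change min (Metric.infDist _ _) 1 = 0
    rw [Metric.infDist_zero_of_mem (h.mem_phaseBox hM k i ht)]
    simp
  simp only [BoundedContinuousFunction.compContinuous_apply, ContinuousMap.coe_mk, h2] at h1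
  have h3 := (tendsto_nhds_unique tendsto_const_nhds h1).symm
  have hint := intervalIntegrable_integral_kernel hT h.prob_limit (truncDist (phaseBox d T M))
  rw [intervalIntegral.integral_of_le hT, ← integral_Icc_eq_integral_Ioc,
    integral_eq_zero_iff_of_nonneg (fun t => integral_nonneg fun z =>
      truncDist_nonneg _ z)
      ((intervalIntegrable_iff_integrableOn_Icc_of_le hT).1 hint)] at h3
  filter_upwards [h3, ae_restrict_mem measurableSet_Icc] with t ht htI
  have := h.prob_limit t htI
  exact measure_compl_eq_zero_of_integral_truncDist (isCompact_phaseBox d T M).isClosed hne ht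

theorem tendsto_integral_density (h : IsLimitFamily p α T M ρ₀ u₀ N x v μ ρ) {t : ℝ}
    (ht : t ∈ Icc 0 T) {f : E d → ℝ} {B : ℝ} {L : NNReal} (hf : ∀ y, |f y| ≤ B)
    (hf' : LipschitzWith L f) :
    Tendsto (fun k => (N k : ℝ)⁻¹ * ∑ i, f (x k i t)) atTop (𝓝 (∫ y, f y ∂(ρ t))) := by
  have h1 := tendsto_integral_of_tendsto_dBL (m := fun k => (atomic (x k) (v k) t).fst)
    (fun ε hε => (h.tendsto_density ε hε).mono fun k hk => hk t ht) hf hf'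
  simpa only [integral_fst_atomic _ _ _ hf'.continuous] using h1

theorem density_compl_closedBall (h : IsLimitFamily p α T M ρ₀ u₀ N x v μ ρ) (hM : 0 ≤ M) {t : ℝ}
    (ht : t ∈ Icc 0 T) : ρ t (Metric.closedBall 0 ((T + 1) * M))ᶜ = 0 := by
  have hT : 0 ≤ T := ht.1.trans ht.2
  have := h.prob_density t ht
  refine measure_compl_eq_zero_of_integral_truncDist Metric.isClosed_closedBall
    (Metric.nonempty_closedBall.2 (by positivity)) ?_
  have h1 := h.tendsto_integral_density ht (f := truncDist (Metric.closedBall 0 ((T + 1) * M)))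
    (B := 1) (L := 1) (fun y => ?_) ((Metric.lipschitz_infDist_pt _).min_const 1)
  · have h2 : ∀ k, (N k : ℝ)⁻¹ * ∑ i, truncDist (Metric.closedBall 0 ((T + 1) * M)) (x k i t)
        = 0 := by
      intro k
      rw [Finset.sum_eq_zero, mul_zero]
      intro i _
      change min (Metric.infDist _ _) 1 = 0
      rw [Metric.infDist_zero_of_mem (h.mem_phaseBox hM k i ht).1]
      simp
    simp only [h2] at h1
    exact (tendsto_nhds_unique tendsto_const_nhds h1).symm
  · change |min (Metric.infDist _ _) 1| ≤ 1
    rw [abs_of_nonneg (le_min Metric.infDist_nonneg zero_le_one)]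
    exact min_le_right _ _

/-- Both sides are weak limits in time of the means of `f` over the particles: the left one by the
space-time convergence, the right one by dominated convergence. -/
theorem ae_integral_fst_eq (h : IsLimitFamily p α T M ρ₀ u₀ N x v μ ρ) (hT : 0 ≤ T)
    {f : E d → ℝ} {B : ℝ} {L : NNReal} (hf : ∀ y, |f y| ≤ B) (hf' : LipschitzWith L f) :
    ∀ᵐ t ∂(volume.restrict (Ioo 0 T)), ∫ z, f z.1 ∂(μ t) = ∫ y, f y ∂(ρ t) := by
  have hfc := hf'.continuous
  set F : ℕ → ℝ → ℝ := fun k t => (N k : ℝ)⁻¹ * ∑ i, f (x k i t) with hF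
  set G : ℝ → ℝ := fun t => ∫ y, f y ∂(ρ t) with hG
  set b : E d × E d →ᵇ ℝ := BoundedContinuousFunction.ofNormedAddCommGroup (fun z => f z.1)
    (by fun_prop) B (fun z => hf z.1) with hb
  have hFc : ∀ k, ContinuousOn (F k) (Icc 0 T) := fun k =>
    continuousOn_const.mul (continuousOn_finsetSum _ fun i _ => hfc.comp_continuousOn
      fun t ht => ((h.solution k).deriv_position i t ht).continuousWithinAt)
  have hFm : ∀ k, AEStronglyMeasurable (F k) (volume.restrict (Icc 0 T)) := fun k =>
    (hFc k).aestronglyMeasurable measurableSet_Icc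
  have hFB : ∀ k t, |F k t| ≤ B := fun k t => by
    have hN : (0 : ℝ) < N k := by exact_mod_cast h.pos_number k
    simp only [hF]
    rw [abs_mul, abs_of_pos (inv_pos.2 hN), inv_mul_le_iff₀ hN]
    refine (Finset.abs_sum_le_sum_abs _ _).trans ((Finset.sum_le_sum fun i _ => hf _).trans ?_)
    simp
  have hlim : ∀ t ∈ Icc 0 T, Tendsto (fun k => F k t) atTop (𝓝 (G t)) := fun t ht =>
    h.tendsto_integral_density ht hf hf'
  have hlim' : ∀ᵐ t ∂(volume.restrict (Icc 0 T)), Tendsto (fun k => F k t) atTop (𝓝 (G t)) :=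
    (ae_restrict_mem measurableSet_Icc).mono hlim
  have hGm : AEStronglyMeasurable G (volume.restrict (Icc 0 T)) :=
    aestronglyMeasurable_of_tendsto_ae _ hFm hlim'
  have hGB : ∀ᵐ t ∂(volume.restrict (Icc 0 T)), ‖G t‖ ≤ B :=
    hlim'.mono fun t ht => le_of_tendsto' ht.norm fun k => hFB k t
  have hGi : IntegrableOn G (Icc 0 T) := Integrable.of_bound hGm B hGB
  have hμi : IntegrableOn (fun t => ∫ z, f z.1 ∂(μ t)) (Icc 0 T) :=
    (intervalIntegrable_iff_integrableOn_Icc_of_le hT).1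
      (intervalIntegrable_integral_kernel hT h.prob_limit b)
  have key := isOpen_Ioo.ae_eq_zero_of_integral_contDiff_smul_eq_zero (U := Ioo 0 T)
    (μ := volume) (f := fun t => ∫ z, f z.1 ∂(μ t) - G t)
    ((hμi.sub hGi).mono_set Ioo_subset_Icc_self).locallyIntegrableOn ?_
  · rw [ae_restrict_iff' measurableSet_Ioo]
    filter_upwards [key] with t ht htI
    exact sub_eq_zero.1 (ht htI)
  intro θ hθ hθc hθs
  have hθcont := hθ.continuous
  obtain ⟨c, hc⟩ := hθc.exists_bound_of_continuous hθcont
  have hc0 : 0 ≤ c := (norm_nonneg _).trans (hc 0)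
  have h1 : Tendsto (fun k => ∫ t in Icc 0 T, θ t * F k t) atTop
      (𝓝 (∫ t in Icc 0 T, θ t * ∫ z, f z.1 ∂(μ t))) := by
    have h2 := h.tendsto_limit (BoundedContinuousFunction.ofNormedAddCommGroup
      (fun y : ℝ × (E d × E d) => θ y.1 * f y.2.1) (by fun_prop) (c * B) fun y => by
        rw [norm_mul]
        exact mul_le_mul (hc _) (hf _) (norm_nonneg _) hc0)
    simpa only [BoundedContinuousFunction.coe_ofNormedAddCommGroup, integral_const_mul,
      intervalIntegral.integral_of_le hT, ← integral_Icc_eq_integral_Ioc,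
      fun k t => integral_atomic (x k) (v k) t fun z => f z.1] using h2
  have h3 : Tendsto (fun k => ∫ t in Icc 0 T, θ t * F k t) atTop
      (𝓝 (∫ t in Icc 0 T, θ t * G t)) := by
    refine tendsto_integral_of_dominated_convergence (fun _ => c * B)
      (fun k => hθcont.aestronglyMeasurable.mul (hFm k)) (integrable_const _) (fun k => ?_) ?_
    · refine Eventually.of_forall fun t => ?_
      rw [norm_mul]
      exact mul_le_mul (hc _) (hFB _ _) (norm_nonneg _) hc0
    · exact hlim'.mono fun t ht => ht.const_mul _
  have h4 := tendsto_nhds_unique h1 h3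
  have hθi : ∀ {u : ℝ → ℝ}, IntegrableOn u (Icc 0 T) →
      IntegrableOn (fun t => θ t * u t) (Icc 0 T) :=
    fun hu => Integrable.bdd_mul hu hθcont.aestronglyMeasurable (c := c) (Eventually.of_forall hc)
  have h5 : ∫ t in Icc 0 T, θ t • (∫ z, f z.1 ∂(μ t) - G t) = 0 := by
    simp only [smul_eq_mul, mul_sub]
    rw [integral_sub (hθi hμi) (hθi hGi), h4, sub_self]
  rw [← h5, ← setIntegral_eq_integral_of_forall_compl_eq_zero]
  intro t ht
  have : θ t = 0 := image_eq_zero_of_notMem_tsupport fun h' =>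
    ht (Ioo_subset_Icc_self (hθs h'))
  simp [this]

theorem ae_fst_eq (h : IsLimitFamily p α T M ρ₀ u₀ N x v μ ρ) (hM : 0 ≤ M) (hT : 0 ≤ T) :
    ∀ᵐ t ∂(volume.restrict (Icc 0 T)), (μ t).fst = ρ t := by
  obtain ⟨g, hg, hgc, hgd⟩ := exists_seq_contDiff_dense_on_compacts (E d)
  have h1 : ∀ᵐ t ∂(volume.restrict (Icc 0 T)), ∀ n, ∫ z, g n z.1 ∂(μ t) = ∫ y, g n y ∂(ρ t) := by
    rw [ae_all_iff]
    intro n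
    obtain ⟨B, hB⟩ := (hgc n).exists_bound_of_continuous (hg n).continuous
    obtain ⟨L, hL⟩ := (hg n).lipschitzWith_of_hasCompactSupport (hgc n) (by simp)
    rw [restrict_Ioo_eq_restrict_Icc.symm]
    exact h.ae_integral_fst_eq hT hB hL
  filter_upwards [h1, h.ae_measure_compl_phaseBox hM hT, ae_restrict_mem measurableSet_Icc]
    with t hgt hμ ht
  have := h.prob_limit t ht
  have := h.prob_density t ht
  have hK : IsCompact (Metric.closedBall (0 : E d) ((T + 1) * M)) := isCompact_closedBall _ _
  refine ext_of_forall_integral_eq_of_IsFiniteMeasure fun f => ?_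
  rw [Measure.fst, integral_map measurable_fst.aemeasurable f.continuous.aestronglyMeasurable,
    ← sub_eq_zero, ← abs_nonpos_iff]
  refine le_of_forall_pos_le_add fun ε hε => ?_
  obtain ⟨n, hn⟩ := hgd f f.continuous _ hK (ε / 2) (half_pos hε)
  have h2 := abs_integral_sub_integral_le (isCompact_phaseBox d T M) hμ
    (f.continuous.comp continuous_fst) ((hg n).continuous.comp continuous_fst)
    (fun z hz => (hn z.1 hz.1).le)
  have h3 := abs_integral_sub_integral_le hK (h.density_compl_closedBall hM ht)
    f.continuous (hg n).continuous (fun z hz => (hn z hz).le)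
  simp only [Function.comp_apply, hgt n] at h2
  rw [abs_sub_comm] at h3
  linarith [abs_sub_le (∫ z, f z.1 ∂(μ t)) (∫ y, g n y ∂(ρ t)) (∫ y, f y ∂(ρ t))]

end IsLimitFamily

/-! ### Limits of monotone quantities along the limit family -/

/-- The function `(x, v) ↦ min (|v|²) (M²)`: the squared speed, truncated so as to be an admissible
test function.  The truncation is not felt on the phase box. -/
noncomputable def truncSpeedSq (d : ℕ) (M : ℝ) : E d × E d →ᵇ ℝ :=
  BoundedContinuousFunction.ofNormedAddCommGroup (fun z => min (‖z.2‖ ^ 2) (M ^ 2))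
    (by fun_prop) (M ^ 2) fun z => by
      rw [Real.norm_of_nonneg (by positivity)]
      exact min_le_right _ _

theorem truncSpeedSq_apply {M : ℝ} {z : E d × E d} (hz : ‖z.2‖ ≤ M) :
    truncSpeedSq d M z = ‖z.2‖ ^ 2 :=
  min_eq_left (pow_le_pow_left₀ (norm_nonneg _) hz 2)

/-- If `C * H ± f` are both monotone, the increments of `f` are bounded by those of `C * H`. -/
theorem abs_sub_le_of_monotoneOn_add_sub {A : Set ℝ} {f H : ℝ → ℝ} {C : ℝ}
    (h1 : MonotoneOn (fun t => C * H t + f t) A) (h2 : MonotoneOn (fun t => C * H t - f t) A)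
    {s t : ℝ} (hs : s ∈ A) (ht : t ∈ A) : |f s - f t| ≤ |C * H s - C * H t| := by
  wlog hst : s ≤ t
  · rw [abs_sub_comm, abs_sub_comm (C * H s)]
    exact this h1 h2 ht hs (le_of_not_ge hst)
  have h3 := h1 hs ht hst
  have h4 := h2 hs ht hst
  simp only at h3 h4
  rw [abs_sub_comm (C * H s)]
  refine (abs_le.2 ⟨?_, ?_⟩).trans (le_abs_self _) <;> linarith

theorem continuousWithinAt_of_monotoneOn_add_sub {A : Set ℝ} {f H : ℝ → ℝ} {C : ℝ}
    (h1 : MonotoneOn (fun t => C * H t + f t) A) (h2 : MonotoneOn (fun t => C * H t - f t) A)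
    {t : ℝ} (ht : t ∈ A) (hH : ContinuousWithinAt H A t) : ContinuousWithinAt f A t := by
  refine tendsto_iff_dist_tendsto_zero.2 (squeeze_zero' (Eventually.of_forall fun _ => dist_nonneg)
    (eventually_mem_nhdsWithin.mono fun s hs => abs_sub_le_of_monotoneOn_add_sub h1 h2 hs ht) ?_)
  have h3 : ContinuousWithinAt (fun s => |C * H s - C * H t|) A t :=
    ((hH.const_mul C).sub continuousWithinAt_const).abs
  simpa [ContinuousWithinAt] using h3

theorem FullMeasureIn.inter {T : ℝ} {A B : Set ℝ} (hA : FullMeasureIn T A)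
    (hB : FullMeasureIn T B) : FullMeasureIn T (A ∩ B) :=
  ⟨inter_subset_left.trans hA.1, by
    rw [sdiff_inter]; exact measure_union_null hA.2 hB.2⟩

theorem FullMeasureIn.iInter {T : ℝ} {A : ℕ → Set ℝ} (hA : ∀ n, FullMeasureIn T (A n)) :
    FullMeasureIn T (⋂ n, A n) :=
  ⟨(iInter_subset _ 0).trans (hA 0).1, by
    rw [sdiff_iInter]; exact measure_iUnion_null fun n => (hA n).2⟩

theorem FullMeasureIn.diff_countable {T : ℝ} {A B : Set ℝ} (hA : FullMeasureIn T A)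
    (hB : B.Countable) : FullMeasureIn T (A \ B) :=
  ⟨sdiff_subset.trans hA.1, by
    rw [sdiff_sdiff_right]
    exact measure_union_null hA.2 (measure_mono_null inter_subset_right (hB.measure_zero _))⟩

namespace IsLimitFamily

/-- Monotonicity in time of an observable, up to a linear drift, passes to the limit family. -/
theorem exists_monotoneOn_integral (h : IsLimitFamily p α T M ρ₀ u₀ N x v μ ρ) (hT : 0 ≤ T)
    (C : ℝ) (b : E d × E d →ᵇ ℝ)
    (hmono : ∀ k, MonotoneOn (fun t => C * t + ∫ z, b z ∂(atomic (x k) (v k) t)) (Icc 0 T)) :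
    ∃ A, FullMeasureIn T A ∧ MonotoneOn (fun t => C * t + ∫ z, b z ∂(μ t)) A := by
  have hlim : ∀ θ : ℝ → ℝ, Continuous θ → HasCompactSupport θ →
      Tendsto (fun k => ∫ t in (0 : ℝ)..T, θ t * (C * t + ∫ z, b z ∂(atomic (x k) (v k) t))) atTop
        (𝓝 (∫ t in (0 : ℝ)..T, θ t * (C * t + ∫ z, b z ∂(μ t)))) := by
    intro θ hθ hθc
    obtain ⟨c₁, hc₁⟩ := hθc.exists_bound_of_continuous hθ
    obtain ⟨c₂, hc₂⟩ := (HasCompactSupport.mul_right hθc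
      (f' := fun t => C * t)).exists_bound_of_continuous (hθ.mul (by fun_prop))
    have hc₁0 : 0 ≤ c₁ := (norm_nonneg _).trans (hc₁ 0)
    let F : (ℝ × (E d × E d)) →ᵇ ℝ := BoundedContinuousFunction.ofNormedAddCommGroup
      (fun y => θ y.1 * (C * y.1) + θ y.1 * b y.2) (by fun_prop) (c₂ + c₁ * ‖b‖) fun y => by
        refine (norm_add_le _ _).trans (add_le_add (hc₂ _) ?_)
        rw [norm_mul]
        exact mul_le_mul (hc₁ _) (b.norm_coe_le_norm _) (norm_nonneg _) hc₁0
    have hF : ∀ (m : Measure (E d × E d)) [IsProbabilityMeasure m] (t : ℝ),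
        ∫ z, F (t, z) ∂m = θ t * (C * t + ∫ z, b z ∂m) := by
      intro m _ t
      change ∫ z, (θ t * (C * t) + θ t * b z) ∂m = _
      rw [integral_add (integrable_const _) ((b.integrable m).const_mul _),
        integral_const_mul (θ t) (fun z => b z), integral_const, probReal_univ, one_smul, mul_add]
    have h1 := h.tendsto_limit F
    have h2 : ∀ k, ∫ t in (0 : ℝ)..T, ∫ z, F (t, z) ∂(atomic (x k) (v k) t) =
        ∫ t in (0 : ℝ)..T, θ t * (C * t + ∫ z, b z ∂(atomic (x k) (v k) t)) := fun k => by
      congr 1 with t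
      have := isProbabilityMeasure_atomic (h.pos_number k) (x k) (v k) t
      exact hF _ t
    have h3 : ∫ t in (0 : ℝ)..T, ∫ z, F (t, z) ∂(μ t) =
        ∫ t in (0 : ℝ)..T, θ t * (C * t + ∫ z, b z ∂(μ t)) :=
      intervalIntegral.integral_congr fun t ht => by
        rw [uIcc_of_le hT] at ht
        have := h.prob_limit t ht
        exact hF _ t
    simpa only [h2, h3] using h1
  obtain ⟨A, hA, hA', hm⟩ := exists_monotoneOn_of_tendsto_integral hmono
    ((Continuous.intervalIntegrable (by fun_prop) _ _).add
      (intervalIntegrable_integral_kernel hT h.prob_limit b)) hT hlim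
  exact ⟨A, ⟨hA, hA'⟩, hm⟩

theorem exists_clock_add (h : IsLimitFamily p α T M ρ₀ u₀ N x v μ ρ) (hp : 1 ≤ p) (hαp : α ≤ p)
    (hM : 0 ≤ M) (hT : 0 ≤ T) {g : E d × E d → ℝ} (hg : ContDiff ℝ ∞ g)
    (hgc : HasCompactSupport g) :
    ∃ C, 0 < C ∧ ∃ A, FullMeasureIn T A ∧ MonotoneOn (fun t =>
      C * (t - ∫ z, truncSpeedSq d M z ∂(μ t)) + ∫ z, g z ∂(μ t)) A := by
  obtain ⟨C, hC, hmono⟩ := exists_monotoneOn_clock_add hp hαp hM T hg hgc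
  obtain ⟨B, hB⟩ := hgc.exists_bound_of_continuous hg.continuous
  let gb : E d × E d →ᵇ ℝ := BoundedContinuousFunction.ofNormedAddCommGroup g hg.continuous B hB
  have key : ∀ (m : Measure (E d × E d)) [IsProbabilityMeasure m],
      ∫ z, (gb - C • truncSpeedSq d M) z ∂m =
        ∫ z, g z ∂m - C * ∫ z, truncSpeedSq d M z ∂m := by
    intro m _
    rw [← integral_const_mul]
    exact integral_sub (gb.integrable m) (((truncSpeedSq d M).integrable m).const_mul C)
  have hmono' : ∀ k, MonotoneOn (fun t =>
      C * t + ∫ z, (gb - C • truncSpeedSq d M) z ∂(atomic (x k) (v k) t)) (Icc 0 T) := by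
    intro k
    refine (hmono (h.pos_number k) (h.solution k) (h.bound_position k) (h.bound_velocity k)).congr
      fun t ht => ?_
    have := isProbabilityMeasure_atomic (h.pos_number k) (x k) (v k) t
    simp only [key, integral_atomic, clock]
    rw [Finset.sum_congr rfl fun i _ => truncSpeedSq_apply
      (mem_closedBall_zero_iff.1 (h.mem_phaseBox hM k i ht).2)]
    ring
  obtain ⟨A, hA, hAm⟩ := h.exists_monotoneOn_integral hT C (gb - C • truncSpeedSq d M) hmono'
  refine ⟨C, hC, A, hA, hAm.congr fun t ht => ?_⟩
  have := h.prob_limit t (hA.1 ht)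
  simp only [key]
  ring

/-! ### Continuity in time of the limit -/

/-- `t ↦ μ_t` is narrowly continuous along a set of full measure.  On such a set every observable of
a countable dense family is controlled by the monotone function `t - ∫ |v|² dμ_t`, which is
discontinuous at countably many times only. -/
theorem exists_continuousWithinAt (h : IsLimitFamily p α T M ρ₀ u₀ N x v μ ρ) (hp : 1 ≤ p)
    (hαp : α ≤ p) (hM : 0 ≤ M) (hT : 0 ≤ T) :
    ∃ A, FullMeasureIn T A ∧ (∀ t ∈ A, μ t (phaseBox d T M)ᶜ = 0) ∧
      ∀ t₀ ∈ A, ∀ f : E d × E d → ℝ, Continuous f →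
        ContinuousWithinAt (fun t => ∫ z, f z ∂(μ t)) A t₀ := by
  obtain ⟨g, hg, hgc, hgd⟩ := exists_seq_contDiff_dense_on_compacts (E d × E d)
  set H : ℝ → ℝ := fun t => t - ∫ z, truncSpeedSq d M z ∂(μ t) with hH
  choose C₁ hC₁ A₁ hA₁ hm₁ using fun n => h.exists_clock_add hp hαp hM hT (hg n) (hgc n)
  choose C₂ hC₂ A₂ hA₂ hm₂ using fun n =>
    h.exists_clock_add hp hαp hM hT (hg n).neg (g := -(g n)) (hgc n).neg
  -- the zero observable: `H` itself is monotone
  obtain ⟨C₀, hC₀, A₀, hA₀, hm₀⟩ := h.exists_clock_add hp hαp hM hT (g := fun _ => 0)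
    contDiff_const HasCompactSupport.zero
  set S : Set ℝ := {t ∈ Icc 0 T | μ t (phaseBox d T M)ᶜ = 0} with hS
  have hSf : FullMeasureIn T S := ⟨fun t ht => ht.1, by
    have h1 := h.ae_measure_compl_phaseBox hM hT
    rw [ae_restrict_iff' measurableSet_Icc] at h1
    exact measure_eq_zero_iff_ae_notMem.2 (h1.mono fun t h2 ht => ht.2 ⟨ht.1, h2 ht.1⟩)⟩
  set A : Set ℝ := (S ∩ A₀) ∩ ⋂ n, (A₁ n ∩ A₂ n) with hA
  have hAf : FullMeasureIn T A :=
    (hSf.inter hA₀).inter (FullMeasureIn.iInter fun n => (hA₁ n).inter (hA₂ n))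
  have hHm : MonotoneOn H A := by
    intro s hs t ht hst
    have h1 := hm₀ hs.1.2 ht.1.2 hst
    simp only [integral_zero, add_zero] at h1
    exact le_of_mul_le_mul_left h1 hC₀
  have hbase : ∀ n t, t ∈ A → ContinuousWithinAt H A t →
      ContinuousWithinAt (fun t => ∫ z, g n z ∂(μ t)) A t := by
    intro n t ht hHt
    have hA1 : A ⊆ A₁ n := fun s hs => (mem_iInter.1 hs.2 n).1
    have hA2 : A ⊆ A₂ n := fun s hs => (mem_iInter.1 hs.2 n).2
    refine continuousWithinAt_of_monotoneOn_add_sub (H := H) (C := C₁ n + C₂ n) ?_ ?_ ht hHt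
    · intro r hr s hs hrs
      have h1 := hm₁ n (hA1 hr) (hA1 hs) hrs
      have h2 := mul_le_mul_of_nonneg_left (hHm hr hs hrs) (hC₂ n).le
      simp only [hH] at h1 h2 ⊢
      linarith
    · intro r hr s hs hrs
      have h1 := hm₂ n (hA2 hr) (hA2 hs) hrs
      have h2 := mul_le_mul_of_nonneg_left (hHm hr hs hrs) (hC₁ n).le
      simp only [hH, Pi.neg_apply, integral_neg] at h1 h2 ⊢
      linarith
  refine ⟨A \ {t ∈ A | ¬ContinuousWithinAt H A t},
    hAf.diff_countable hHm.countable_not_continuousWithinAt, fun t ht => ht.1.1.1.2, ?_⟩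
  rintro t₀ ht₀ f hf
  have hHt : ContinuousWithinAt H A t₀ := by
    by_contra hn; exact ht₀.2 ⟨ht₀.1, hn⟩
  refine ContinuousWithinAt.mono ?_ sdiff_subset
  refine continuousWithinAt_of_locally_uniform_approx_of_continuousWithinAt ht₀.1 fun u hu => ?_
  obtain ⟨ε, hε, hεu⟩ := Metric.mem_uniformity_dist.1 hu
  obtain ⟨n, hn⟩ := hgd f hf _ (isCompact_phaseBox d T M) (ε / 2) (half_pos hε)
  refine ⟨A, self_mem_nhdsWithin, fun t => ∫ z, g n z ∂(μ t), hbase n t₀ ht₀.1 hHt,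
    fun t ht => hεu ?_⟩
  have := h.prob_limit t ht.1.1.1
  have h1 := abs_integral_sub_integral_le (isCompact_phaseBox d T M) ht.1.1.2 hf
    (hg n).continuous fun z hz => (hn z hz).le
  rw [Real.dist_eq]
  linarith

/-! ### Local mass preservation -/

theorem locallyMassPreserving (h : IsLimitFamily p α T M ρ₀ u₀ N x v μ ρ) (hM : 0 ≤ M) :
    LocallyMassPreserving T M ρ := by
  intro C hC t₀ t ht₀ ht₀t htT
  rcases C.eq_empty_or_nonempty with rfl | hne
  · simp
  have hK : IsCompact (closure C) := hC.isCompact_closure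
  have hI₀ : t₀ ∈ Icc 0 T := ⟨ht₀, ht₀t.trans htT⟩
  have hI : t ∈ Icc 0 T := ⟨ht₀.trans ht₀t, htT⟩
  have := h.prob_density t₀ hI₀
  have := h.prob_density t hI
  set r : ℝ := (t - t₀) * M with hr
  have hr0 : 0 ≤ r := mul_nonneg (by linarith) hM
  have hset : closure C + (t - t₀) • Metric.closedBall (0 : E d) M =
      Metric.cthickening r (closure C) := by
    rw [smul_closedBall _ _ hM, smul_zero, Real.norm_of_nonneg (by linarith),
      hK.add_closedBall_zero hr0]
  rw [hset]
  have key : ∀ δ > 0, ρ t₀ C ≤ ρ t (Metric.cthickening δ (Metric.cthickening r (closure C))) := by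
    intro δ hδ
    rw [cthickening_cthickening hδ.le hr0]
    -- `ψ` is a cutoff of slope `1 / δ` between the values `1` on `s ≤ 0` and `0` on `δ ≤ s`
    set ψ : ℝ → ℝ := fun s => max 0 (min 1 (1 - δ⁻¹ * s)) with hψ
    have hψ0 : ∀ s, 0 ≤ ψ s := fun s => le_max_left _ _
    have hψ1 : ∀ s, ψ s ≤ 1 := fun s => max_le zero_le_one (min_le_left _ _)
    have hψabs : ∀ s, |ψ s| ≤ 1 := fun s => by rw [abs_of_nonneg (hψ0 s)]; exact hψ1 s
    have hψanti : Antitone ψ := fun a b hab => by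
      have : δ⁻¹ * a ≤ δ⁻¹ * b := mul_le_mul_of_nonneg_left hab (by positivity)
      exact max_le_max le_rfl (min_le_min le_rfl (by linarith))
    have hψlip : ∀ c, LipschitzWith (Real.toNNReal δ⁻¹)
        fun y => ψ (Metric.infDist y (closure C) - c) := fun c => by
      refine LipschitzWith.const_max (LipschitzWith.const_min
        (LipschitzWith.of_dist_le_mul fun y z => ?_) 1) 0
      have h1 := (Metric.lipschitz_infDist_pt (closure C)).dist_le_mul y z
      rw [NNReal.coe_one, one_mul, Real.dist_eq] at h1
      rw [Real.coe_toNNReal _ (by positivity), Real.dist_eq]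
      calc _ = δ⁻¹ * |Metric.infDist y (closure C) - Metric.infDist z (closure C)| := by
            rw [← abs_of_pos (inv_pos.2 hδ), ← abs_mul, abs_of_pos (inv_pos.2 hδ), ← abs_neg]
            congr 1
            ring
        _ ≤ _ := mul_le_mul_of_nonneg_left h1 (by positivity)
    have hint : ∀ c (m : Measure (E d)) [IsProbabilityMeasure m],
        Integrable (fun y => ψ (Metric.infDist y (closure C) - c)) m := fun c m _ =>
      Integrable.of_bound (hψlip c).continuous.aestronglyMeasurable 1
        (Eventually.of_forall fun y => hψabs _)
    -- the particles move at speed at most `M`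
    have hle : ∫ y, ψ (Metric.infDist y (closure C) - 0) ∂(ρ t₀) ≤
        ∫ y, ψ (Metric.infDist y (closure C) - r) ∂(ρ t) := by
      refine le_of_tendsto_of_tendsto'
        (h.tendsto_integral_density hI₀ (fun y => hψabs _) (hψlip 0))
        (h.tendsto_integral_density hI (fun y => hψabs _) (hψlip r)) fun k => ?_
      refine mul_le_mul_of_nonneg_left (Finset.sum_le_sum fun i _ => hψanti ?_) (by positivity)
      have h1 := (h.solution k).norm_position_sub_le hM (h.bound_velocity k) ht₀ ht₀t htT i
      have h2 := Metric.infDist_le_infDist_add_dist (s := closure C) (x := x k i t) (y := x k i t₀)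
      rw [dist_eq_norm] at h2
      rw [hr]
      linarith
    have hleft : (ρ t₀).real (closure C) ≤
        ∫ y, ψ (Metric.infDist y (closure C) - 0) ∂(ρ t₀) := by
      rw [← integral_indicator_one isClosed_closure.measurableSet]
      refine integral_mono ((integrable_const _).indicator isClosed_closure.measurableSet)
        (hint 0 _) fun y => ?_
      by_cases hy : y ∈ closure C
      · simp [hψ, hy, Metric.infDist_zero_of_mem hy]
      · rw [indicator_of_notMem hy]
        exact hψ0 _
    have hright : ∫ y, ψ (Metric.infDist y (closure C) - r) ∂(ρ t) ≤
        (ρ t).real (Metric.cthickening (δ + r) (closure C)) := by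
      have hm := (Metric.isClosed_cthickening (δ := δ + r) (E := closure C)).measurableSet
      rw [← integral_indicator_one hm]
      refine integral_mono (hint r _) ((integrable_const _).indicator hm) fun y => ?_
      by_cases hy : y ∈ Metric.cthickening (δ + r) (closure C)
      · rw [indicator_of_mem hy]
        exact hψ1 _
      rw [indicator_of_notMem hy]
      rw [hK.cthickening_eq_biUnion_closedBall (by linarith)] at hy
      obtain ⟨z, hz, hyz⟩ := hK.exists_infDist_eq_dist hne.closure y
      have h1 : δ + r < Metric.infDist y (closure C) := by
        rw [hyz]
        by_contra hn
        exact hy (mem_biUnion hz (not_lt.1 hn))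
      have h2 : 1 ≤ δ⁻¹ * (Metric.infDist y (closure C) - r) := by
        rw [le_inv_mul_iff₀ hδ]; linarith
      exact max_le le_rfl ((min_le_right _ _).trans (by linarith))
    calc ρ t₀ C ≤ ρ t₀ (closure C) := measure_mono subset_closure
      _ ≤ _ := (ENNReal.toReal_le_toReal (measure_ne_top _ _) (measure_ne_top _ _)).1
        (hleft.trans (hle.trans hright))
  have hlim := tendsto_measure_cthickening_of_isCompact (μ := ρ t) (hK.cthickening (r := r))
  exact ge_of_tendsto (hlim.mono_left (nhdsWithin_le_nhds (s := Ioi 0)))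
    (eventually_mem_nhdsWithin.mono fun δ hδ => key δ hδ)

/-! ### The flowed measures -/

/-- Continuity at `t₀` of `t ↦ μ_t` along `A` is inherited by integrals of jointly continuous
functions of time and state, as these vary uniformly on the compact phase box. -/
theorem tendsto_integral_of_continuous (h : IsLimitFamily p α T M ρ₀ u₀ N x v μ ρ) {A : Set ℝ}
    (hA : A ⊆ Icc 0 T) (hsupp : ∀ t ∈ A, μ t (phaseBox d T M)ᶜ = 0) {t₀ : ℝ}
    {F : ℝ → E d × E d → ℝ} (hF : Continuous (Function.uncurry F))
    (hcont : ContinuousWithinAt (fun t => ∫ z, F t₀ z ∂(μ t)) A t₀) :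
    Tendsto (fun t => ∫ z, F t z ∂(μ t)) (𝓝[A] t₀) (𝓝 (∫ z, F t₀ z ∂(μ t₀))) := by
  have hFt : ∀ t, Continuous (F t) := fun t => hF.comp (by fun_prop : Continuous fun z => (t, z))
  have h1 : Tendsto (fun t => ∫ z, F t z ∂(μ t) - ∫ z, F t₀ z ∂(μ t)) (𝓝[A] t₀) (𝓝 0) := by
    rw [Metric.tendsto_nhds]
    intro ε hε
    have h2 : ∀ᶠ t in 𝓝 t₀, ∀ z ∈ phaseBox d T M, |F t z - F t₀ z| < ε / 2 := by
      refine (isCompact_phaseBox d T M).eventually_forall_of_forall_eventually fun z _ => ?_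
      have h3 : Continuous fun y : ℝ × (E d × E d) => |F y.1 y.2 - F t₀ y.2| :=
        (hF.sub ((hFt t₀).comp continuous_snd)).abs
      exact h3.continuousAt.eventually_lt continuousAt_const (by simpa using hε)
    filter_upwards [nhdsWithin_le_nhds h2, self_mem_nhdsWithin] with t ht htA
    have := h.prob_limit t (hA htA)
    have h4 := abs_integral_sub_integral_le (isCompact_phaseBox d T M) (hsupp t htA) (hFt t)
      (hFt t₀) fun z hz => (ht z hz).le
    rw [Real.dist_eq, sub_zero]
    linarith
  simpa using h1.add hcont

end IsLimitFamily

theorem continuous_flowBack (t₀ : ℝ) :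
    Continuous fun y : ℝ × (E d × E d) => flowBack t₀ y.1 y.2 := by
  unfold flowBack; fun_prop

theorem integral_map_flowBack (m : Measure (E d × E d)) (t₀ t : ℝ) {f : E d × E d → ℝ}
    (hf : Continuous f) :
    ∫ z, f z ∂(m.map (flowBack t₀ t)) = ∫ z, f (flowBack t₀ t z) ∂m :=
  integral_map (by unfold flowBack; fun_prop) hf.aestronglyMeasurable

theorem integral_flowedDensity (μ : ℝ → Measure (E d × E d)) (t₀ t : ℝ) {φ ξ : E d → ℝ}
    (hφ : Continuous φ) (hφ0 : ∀ w, 0 ≤ φ w) (hξ : Continuous ξ) :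
    ∫ y, ξ y ∂(flowedDensity μ φ t₀ t) = ∫ z, φ z.2 * ξ (flowBack t₀ t z).1 ∂(μ t) := by
  rw [flowedDensity, integral_map measurable_fst.aemeasurable hξ.aestronglyMeasurable,
    integral_withDensity_eq_integral_toReal_smul (by fun_prop) (by simp)]
  simp only [ENNReal.toReal_ofReal (hφ0 _), smul_eq_mul]
  exact integral_map_flowBack (μ t) t₀ t (f := fun z => φ z.2 * ξ z.1) (by fun_prop)

end PAlign

theorem proposition5p4 {d : ℕ} (p α T M : ℝ) (hp : 1 ≤ p) (hα : 0 < α) (hαp : α ≤ p)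
    (hT : 0 < T) (hM : 0 < M)
    (ρ₀ : Measure (PAlign.E d)) (u₀ : PAlign.E d → PAlign.E d)
    (N : ℕ → ℕ) (x v : ∀ k, Fin (N k) → ℝ → PAlign.E d)
    (μ : ProbabilityTheory.Kernel ℝ (PAlign.E d × PAlign.E d)) (ρ : ℝ → Measure (PAlign.E d))
    (h : PAlign.IsLimitFamily p α T M ρ₀ u₀ N x v μ ρ) :
    -- the local density of `μ_t` is `ρ_t`, and `μ_t` is supported in `(T+1) B(M) × B(M)`
    (∀ᵐ t ∂(volume.restrict (Icc 0 T)), (μ t).fst = ρ t ∧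
      μ t (Metric.closedBall 0 ((T + 1) * M) ×ˢ Metric.closedBall 0 M)ᶜ = 0) ∧
    PAlign.LocallyMassPreserving T M ρ ∧
    PAlign.SteadilyFlowing T (fun t => μ t) ∧
    (∃ A : Set ℝ, PAlign.FullMeasureIn T A ∧ ∀ t₀ ∈ A,
      PAlign.NarrowContWithinAt (fun t => (μ t).map (PAlign.flowBack t₀ t)) A t₀) := by
  obtain ⟨A, hA, hsupp, hcont⟩ := h.exists_continuousWithinAt hp hαp hM.le hT.le
  refine ⟨(h.ae_fst_eq hM.le hT.le).and (h.ae_measure_compl_phaseBox hM.le hT.le),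
    h.locallyMassPreserving hM.le, ⟨A, hA, ?_⟩, ⟨A, hA, ?_⟩⟩
  · intro t₀ ht₀ φ hφ _ hφ0 ξ
    have hφc := hφ.continuous
    simp only [PAlign.integral_flowedDensity (fun t => μ t) _ _ hφc hφ0 ξ.continuous]
    have hF : Continuous (Function.uncurry fun t (z : PAlign.E d × PAlign.E d) =>
        φ z.2 * ξ (PAlign.flowBack t₀ t z).1) :=
      (hφc.comp (by fun_prop)).mul (ξ.continuous.comp
        (continuous_fst.comp (PAlign.continuous_flowBack t₀)))
    exact h.tendsto_integral_of_continuous hA.1 hsupp hF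
      (hcont t₀ ht₀ _ (hF.comp (by fun_prop : Continuous fun z => (t₀, z))))
  · intro t₀ ht₀ ξ
    simp only [PAlign.integral_map_flowBack _ _ _ ξ.continuous]
    have hF : Continuous (Function.uncurry fun t (z : PAlign.E d × PAlign.E d) =>
        ξ (PAlign.flowBack t₀ t z)) := ξ.continuous.comp (PAlign.continuous_flowBack t₀)
    exact h.tendsto_integral_of_continuous hA.1 hsupp hF
      (hcont t₀ ht₀ _ (hF.comp (by fun_prop : Continuous fun z => (t₀, z))))
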